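/- Let $B=\prod_{k=1}^n[l_k,u_k]\subset\mathbb{R}^n$ with $l_k<u_k$ for all $k$, and let $f$ be a real function that is twice continuously differentiable and convex on $B$. Let $X_1,X_2,\ldots$ be i.i.d. random vectors in $\mathbb{R}^n$ with $E\|X_1\|^2<\infty$, $P(X_i\in B)=1$, and $P(X_i\in S)>0$ for every full-dimensional set $S\subseteq B$ (i.e. every $S\subseteq B$ with nonempty interior). Let $Y_i=f(X_i)+\nu_i$, where the $\nu_i$ are real random variables with $E[\nu_i^2]<\infty$ and $E[\nu_i\mid X_i]=0$ almost surely, where for every $m$ $$P(\nu_1\in A_1,\ldots,\nu_m\in A_m\mid X_1,\ldots,X_m)=\prod_{i=1}^m P(\nu_i\in A_i\mid X_i)\quad\text{a.s., for all Borel sets }A_1,\ldots,A_m\subseteq\mathbb{R},$$ and where the pairs $(X_i,\nu_i)$ are identically distributed. For $m,d\in\mathbb{N}$ let $\bar g_{m,d}$ denote any minimizer of $\sum_{i=1}^m(Y_i-g(X_i))^2$ over all real polynomials $g$ in $n$ variables of degree at most $d$ whose Hessian $H_g(x)$ is positive semidefinite for every $x\in B$. Let $C\subseteq B$ be a compact set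 with nonempty interior that contains no boundary point of $B$. Then: (a) Almost surely there is an $m_0$ such that a minimizer $\bar g_{m,d}$ exists for all $m\ge m_0$ and all $d$. (b) Almost surely, $\sup_{x\in C}|\bar g_{m,d}(x)-f(x)|\to0$ as $m\to\infty$ and then $d\to\infty$: for every $\varepsilon>0$ there is a $d_0$ such that for every $d\ge d_0$ there is an $m_0$ such that for every $m\ge m_0$ every minimizer $\bar g_{m,d}$ satisfies $\sup_{x\in C}|\bar g_{m,d}(x)-f(x)|\le\varepsilon$. (c) If moreover $P(X_1\in\partial B)=0$, then almost surely $\sup_{x\in C}|\bar g_{m,d}(x)-f(x)|\to0$ jointly as $m,d\to\infty$: for every $\varepsilon>0$ there is an $N$ such that for all $m,d\ge N$ every minimizer $\bar g_{m,d}$ satisfies $\sup_{x\in C}|\bar g_{m,d}(x)-f(x)|\le\varepsilon$. -/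

import Mathlib

open MeasureTheory ProbabilityTheory

/-- The Hessian matrix of a real polynomial `g` in `n` variables at the point `x`. -/
noncomputable def polyHessian {n : ℕ} (g : MvPolynomial (Fin n) ℝ) (x : Fin n → ℝ) :
    Matrix (Fin n) (Fin n) ℝ :=
  Matrix.of fun i j => MvPolynomial.eval x (MvPolynomial.pderiv i (MvPolynomial.pderiv j g))

/-- Polynomials in `n` variables, of total degree at most `d`, whose Hessian is positive
semidefinite at every point of the box `[l₁, u₁] × ⋯ × [lₙ, uₙ]`. -/
def convexPolys {n : ℕ} (l u : Fin n → ℝ) (d : ℕ) : Set (MvPolynomial (Fin n) ℝ) :=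
  {g | g.totalDegree ≤ d ∧ ∀ x ∈ Set.Icc l u, (polyHessian g x).PosSemidef}

/-- The least-squares loss of `g` on the data points `(x 0, y 0), …, (x (m - 1), y (m - 1))`. -/
noncomputable def lsLoss {n : ℕ} (x : ℕ → Fin n → ℝ) (y : ℕ → ℝ) (m : ℕ)
    (g : MvPolynomial (Fin n) ℝ) : ℝ :=
  ∑ i ∈ Finset.range m, (y i - MvPolynomial.eval (x i) g) ^ 2

/-- `g` is an exact convex-constrained least-squares polynomial regressor of degree `d` for the
first `m` data points: a minimizer of the loss over all polynomials of degree at most `d` with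
positive semidefinite Hessian on the box. -/
def IsConvexRegressor {n : ℕ} (l u : Fin n → ℝ) (x : ℕ → Fin n → ℝ) (y : ℕ → ℝ) (m d : ℕ)
    (g : MvPolynomial (Fin n) ℝ) : Prop :=
  g ∈ convexPolys l u d ∧ ∀ h ∈ convexPolys l u d, lsLoss x y m g ≤ lsLoss x y m h

/-! The argument is deterministic on one almost sure event, described by `RegularSample`: every open
set meeting the interior of the box receives a positive fraction of the samples, the squared noises
have a convergent average, and the noise averages to zero against every polynomial and on every grid
cell. Countably many strong laws give this event (`ae_regularSample`); they need only pairwise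
independence of the pairs `(X i, ν i)`, which follows from the conditional product formula.

Convexity supplies compactness. A convex function bounded at one sample near each corner and one
near the center is bounded on an inner box (`ConvexOn.abs_le_of_anchorBox`), hence Lipschitz further
inside. This makes the loss coercive on each cone of polynomials, so minimizers exist, from a sample
size that does not depend on the degree. It also makes all regressors uniformly Lipschitz near `C`,
so smallness of the empirical mean square of `g - f` forces uniform smallness on `C`
(`exists_uniform_close`).

To make this mean square small, fix a convex polynomial `h` uniformly close to `f`
(`exists_convex_polynomial_near`). Once `d` reaches the degree of `h`, optimality of `g` in a convex
set gives `∑ (g - h)² ≤ ∑ (y - h)(g - h)`, and only the noise term `∑ ν (g - h)` remains. For fixed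
`d`, `g - h` has bounded coordinates in a finite-dimensional space, so the noise averages against a
basis suffice. For the joint limit, `g - h` is instead replaced by a function constant on small
cells, at a cost uniform in `d`; near the boundary, where no Lipschitz bound is available, the noise
has little energy because the boundary is not charged. -/

/-! ### Hessians of polynomials and convexity -/

theorem MvPolynomial.pderiv_pderiv_comm {σ R : Type*} [CommRing R] (i j : σ)
    (g : MvPolynomial σ R) : pderiv i (pderiv j g) = pderiv j (pderiv i g) := by
  classical
  have h : ⁅(pderiv i : Derivation R (MvPolynomial σ R) (MvPolynomial σ R)),
      (pderiv j : Derivation R (MvPolynomial σ R) (MvPolynomial σ R))⁆ = 0 := by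
    refine MvPolynomial.derivation_ext fun k => ?_
    rw [Derivation.commutator_apply, pderiv_X, pderiv_X, Pi.single_apply, Pi.single_apply]
    split_ifs <;> simp
  have := congrArg (fun D => D g) h
  simpa [Derivation.commutator_apply, sub_eq_zero] using this

theorem MvPolynomial.hasDerivAt_eval_line {n : ℕ} (g : MvPolynomial (Fin n) ℝ)
    (x v : Fin n → ℝ) (s : ℝ) :
    HasDerivAt (fun s : ℝ => eval (x + s • v) g) (∑ i, v i * eval (x + s • v) (pderiv i g)) s := by
  classical
  induction g using MvPolynomial.induction_on with
  | C a => simpa using hasDerivAt_const s a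
  | add p q hp hq =>
    simpa [mul_add, Finset.sum_add_distrib] using hp.fun_add hq
  | mul_X p k hp =>
    have h1 : HasDerivAt (fun s : ℝ => x k + s * v k) (v k) s := by
      simpa using ((hasDerivAt_id s).mul_const (v k)).const_add (x k)
    have h2 := hp.fun_mul h1
    simp only [map_mul, eval_X, Pi.add_apply, Pi.smul_apply, smul_eq_mul, Derivation.leibniz,
      pderiv_X, map_add]
    refine h2.congr_deriv ?_
    simp only [Pi.single_apply, apply_ite, map_one, map_zero, mul_one, mul_zero, mul_add,
      Finset.sum_add_distrib]
    rw [Finset.sum_ite_eq Finset.univ k]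
    simp only [Finset.mem_univ, if_true, Finset.sum_mul]
    rw [add_comm, mul_comm (v k)]
    congr 1
    rw [← Finset.sum_add_distrib]
    exact Finset.sum_congr rfl fun i _ => by ring

theorem MvPolynomial.deriv_eval_line {n : ℕ} (g : MvPolynomial (Fin n) ℝ) (x v : Fin n → ℝ) :
    deriv (fun s : ℝ => eval (x + s • v) g) =
      fun s : ℝ => ∑ i, v i * eval (x + s • v) (pderiv i g) :=
  _root_.funext fun s => (hasDerivAt_eval_line g x v s).deriv

theorem MvPolynomial.hasDerivAt_deriv_eval_line {n : ℕ} (g : MvPolynomial (Fin n) ℝ)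
    (x v : Fin n → ℝ) (s : ℝ) :
    HasDerivAt (deriv fun s : ℝ => eval (x + s • v) g)
      (v ⬝ᵥ (polyHessian g (x + s • v)).mulVec v) s := by
  rw [deriv_eval_line]
  have h := HasDerivAt.fun_sum (u := Finset.univ) fun (i : Fin n) _ =>
    (hasDerivAt_eval_line (pderiv i g) x v s).const_mul (v i)
  refine h.congr_deriv ?_
  simp only [dotProduct, Matrix.mulVec, polyHessian, Matrix.of_apply]
  refine Finset.sum_congr rfl fun i _ => ?_
  congr 1
  refine Finset.sum_congr rfl fun j _ => ?_
  rw [pderiv_pderiv_comm, mul_comm]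

theorem convexOn_eval_of_posSemidef {n : ℕ} {K : Set (Fin n → ℝ)} (hK : Convex ℝ K)
    {g : MvPolynomial (Fin n) ℝ} (h : ∀ x ∈ K, (polyHessian g x).PosSemidef) :
    ConvexOn ℝ K fun x => MvPolynomial.eval x g := by
  refine ⟨hK, fun x hx y hy a b ha hb hab => ?_⟩
  have hseg : ∀ s ∈ Set.Icc (0 : ℝ) 1, x + s • (y - x) ∈ K := fun s hs => by
    have := hK hx hy (sub_nonneg.2 hs.2) hs.1 (by ring)
    convert this using 1
    module
  have hc : ConvexOn ℝ (Set.Icc (0 : ℝ) 1) fun s : ℝ => MvPolynomial.eval (x + s • (y - x)) g := by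
    refine convexOn_of_deriv2_nonneg' (convex_Icc 0 1)
      (fun s _ =>
        (MvPolynomial.hasDerivAt_eval_line g x _ s).differentiableAt.differentiableWithinAt)
      (fun s _ => (MvPolynomial.hasDerivAt_deriv_eval_line g x _
        s).differentiableAt.differentiableWithinAt) fun s hs => ?_
    change 0 ≤ deriv (deriv _) s
    rw [(MvPolynomial.hasDerivAt_deriv_eval_line g x _ s).deriv]
    simpa using (h _ (hseg s hs)).dotProduct_mulVec_nonneg (y - x)
  have := hc.2 (Set.left_mem_Icc.2 zero_le_one) (Set.right_mem_Icc.2 zero_le_one) ha hb hab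
  simp only [smul_eq_mul, mul_zero, mul_one, zero_add, zero_smul, add_zero, one_smul,
    add_sub_cancel] at this
  have e : a • x + b • y = x + b • (y - x) := by
    rw [← eq_sub_iff_add_eq] at hab
    subst hab
    module
  rw [e]
  simpa using this

/-- In a direction of negative curvature, the even function `s ↦ g (x + s v) + g (x - s v)` would
have a local maximum at 0 by the second derivative test and a local minimum by hypothesis, hence be
locally constant, contradicting its negative second derivative. The criterion uses values only, so a
convolution can be tested without differentiating under the integral. -/
theorem polyHessian_posSemidef_of_second_difference {n : ℕ} {g : MvPolynomial (Fin n) ℝ}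
    {x : Fin n → ℝ}
    (h : ∀ v : Fin n → ℝ, ‖v‖ ≤ 1 → 0 ≤ MvPolynomial.eval (x + v) g +
      MvPolynomial.eval (x - v) g - 2 * MvPolynomial.eval x g) :
    (polyHessian g x).PosSemidef := by
  refine Matrix.PosSemidef.of_dotProduct_mulVec_nonneg ?_ fun v => ?_
  · ext i j
    simp [polyHessian, Matrix.conjTranspose, MvPolynomial.pderiv_pderiv_comm i j]
  rw [star_trivial]
  by_contra hneg
  push Not at hneg
  set p : ℝ → ℝ := fun s => MvPolynomial.eval (x + s • v) g with hp
  set q : ℝ → ℝ := fun s => p s + p (-s) with hq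
  have hdp : ∀ s, HasDerivAt p (deriv p s) s := fun s =>
    (MvPolynomial.hasDerivAt_eval_line g x v s).differentiableAt.hasDerivAt
  have hddp : ∀ s, HasDerivAt (deriv p) (v ⬝ᵥ (polyHessian g (x + s • v)).mulVec v) s := fun s =>
    MvPolynomial.hasDerivAt_deriv_eval_line g x v s
  have hdq : ∀ s, HasDerivAt q (deriv p s - deriv p (-s)) s := fun s => by
    have := (hdp s).add ((hdp (-s)).comp s (hasDerivAt_neg s))
    simpa [sub_eq_add_neg, Function.comp_def, Pi.add_def, hq] using this
  have hdq' : deriv q = fun s => deriv p s - deriv p (-s) := funext fun s => (hdq s).deriv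
  have hddq : deriv (deriv q) 0 = 2 * (v ⬝ᵥ (polyHessian g x).mulVec v) := by
    rw [hdq']
    have h0 := (hddp 0).sub ((hddp (-0)).comp 0 (hasDerivAt_neg 0))
    simp only [neg_zero, zero_smul, add_zero] at h0
    have := h0.deriv
    simp only [Pi.sub_def, Function.comp_def] at this
    rw [this]
    ring
  have hmin : ∀ᶠ s in nhds (0 : ℝ), q 0 ≤ q s := by
    have hc : Filter.Tendsto (fun s : ℝ => ‖s • v‖) (nhds 0) (nhds 0) := by
      have : Continuous fun s : ℝ => ‖s • v‖ := by fun_prop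
      simpa using this.tendsto 0
    filter_upwards [hc.eventually (gt_mem_nhds (zero_lt_one))] with s hs
    have := h (s • v) hs.le
    simp only [hq, hp, neg_smul, zero_smul, add_zero, ← sub_eq_add_neg, sub_zero]
    linarith
  have hmax : ∀ᶠ s in nhds (0 : ℝ), q s ≤ q 0 :=
    isLocalMax_of_deriv_deriv_neg (by rw [hddq]; linarith) (by simp [hdq']) (hdq 0).continuousAt
  have hconst : q =ᶠ[nhds 0] fun _ => q 0 := by
    filter_upwards [hmin, hmax] with s h1 h2 using le_antisymm h2 h1
  have : deriv (deriv q) 0 = 0 := by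
    rw [hconst.deriv.deriv_eq]
    simp
  linarith

/-! ### Uniform approximation by convex polynomials -/

/-- The extension is the infimal convolution of `f` with `K ‖·‖`: joint convexity in `(x, y)` passes
to the infimum over `y`. -/
theorem LipschitzOnWith.exists_convex_extension {E : Type*} [NormedAddCommGroup E]
    [NormedSpace ℝ E] {s : Set E} (hne : s.Nonempty) {f : E → ℝ} {K : NNReal}
    (hf : LipschitzOnWith K f s) (hc : ConvexOn ℝ s f) :
    ∃ F : E → ℝ, LipschitzWith K F ∧ ConvexOn ℝ Set.univ F ∧ Set.EqOn F f s := by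
  have : Nonempty s := hne.to_subtype
  obtain ⟨y₀, hy₀⟩ := hne
  have hlip : ∀ y ∈ s, ∀ z ∈ s, f y ≤ f z + K * ‖y - z‖ := fun y hy z hz => by
    have := hf.dist_le_mul y hy z hz
    rw [Real.dist_eq, dist_eq_norm] at this
    linarith [le_abs_self (f y - f z)]
  have hlow : ∀ z ∈ s, ∀ (x : E) (y : s), f z - K * ‖x - z‖ ≤ f y + K * ‖x - y‖ :=
      fun z hz x y => by
    have h1 := hlip z hz y y.2
    have h2 : ‖z - (y : E)‖ ≤ ‖x - z‖ + ‖x - y‖ := by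
      rw [show z - (y : E) = (x - y) - (x - z) by abel]
      linarith [_root_.norm_sub_le (x - (y : E)) (x - z)]
    nlinarith [K.coe_nonneg, mul_le_mul_of_nonneg_left h2 K.coe_nonneg]
  have hbdd : ∀ x : E, BddBelow (Set.range fun y : s => f y + K * ‖x - (y : E)‖) := fun x =>
    ⟨f y₀ - K * ‖x - y₀‖, by rintro _ ⟨y, rfl⟩; exact hlow y₀ hy₀ x y⟩
  refine ⟨fun x => ⨅ y : s, f y + K * ‖x - (y : E)‖, ?_, ⟨convex_univ, ?_⟩, ?_⟩
  · refine LipschitzWith.of_le_add_mul K fun x x' => ?_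
    rw [← sub_le_iff_le_add]
    refine le_ciInf fun y => ?_
    have h1 := ciInf_le (hbdd x) y
    have h2 : ‖x - (y : E)‖ ≤ dist x x' + ‖x' - y‖ := by
      rw [dist_eq_norm, show x - (y : E) = (x - x') + (x' - y) by abel]
      exact norm_add_le _ _
    have h3 := mul_le_mul_of_nonneg_left h2 K.coe_nonneg
    linarith
  · intro x₁ _ x₂ _ a b ha hb hab
    refine le_of_forall_pos_le_add fun η hη => ?_
    obtain ⟨y₁, h₁⟩ := exists_lt_of_ciInf_lt
      (lt_add_of_pos_right (⨅ y : s, f y + K * ‖x₁ - y‖) hη)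
    obtain ⟨y₂, h₂⟩ := exists_lt_of_ciInf_lt
      (lt_add_of_pos_right (⨅ y : s, f y + K * ‖x₂ - y‖) hη)
    have hm := hc.1 y₁.2 y₂.2 ha hb hab
    refine (ciInf_le (hbdd _) ⟨_, hm⟩).trans ?_
    have h3 := hc.2 y₁.2 y₂.2 ha hb hab
    have h4 : ‖a • x₁ + b • x₂ - (a • (y₁ : E) + b • (y₂ : E))‖
        ≤ a * ‖x₁ - y₁‖ + b * ‖x₂ - y₂‖ := by
      rw [show a • x₁ + b • x₂ - (a • (y₁ : E) + b • (y₂ : E))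
        = a • (x₁ - y₁) + b • (x₂ - y₂) by module]
      refine (norm_add_le _ _).trans ?_
      rw [norm_smul, norm_smul, Real.norm_of_nonneg ha, Real.norm_of_nonneg hb]
    simp only [smul_eq_mul] at h3 ⊢
    have h5 := mul_le_mul_of_nonneg_left h4 K.coe_nonneg
    have h6 := mul_le_mul_of_nonneg_left h₁.le ha
    have h7 := mul_le_mul_of_nonneg_left h₂.le hb
    have h8 : a * η + b * η = η := by rw [← add_mul, hab, one_mul]
    linarith
  · intro z hz
    refine le_antisymm ?_ (le_ciInf fun y => ?_)
    · simpa using ciInf_le (hbdd z) ⟨z, hz⟩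
    · simpa using hlow z hz z y

theorem ContDiff.exists_abs_second_difference_le {E : Type*} [NormedAddCommGroup E]
    [NormedSpace ℝ E] {χ : E → ℝ} (hχ : ContDiff ℝ 2 χ) (hs : HasCompactSupport χ) :
    ∃ M : ℝ, 0 ≤ M ∧ ∀ z h, |χ (z + h) + χ (z - h) - 2 * χ z| ≤ M * ‖h‖ ^ 2 := by
  obtain ⟨C, hC⟩ := ContDiff.lipschitzWith_of_hasCompactSupport (n := 1) (𝕂 := ℝ) (hs.fderiv ℝ)
    (hχ.fderiv_right (by norm_num)) (by norm_num)
  have key : ∀ z h, |χ (z + h) - χ z - fderiv ℝ χ z h| ≤ C * ‖h‖ ^ 2 := fun z h => by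
    have := Convex.norm_image_sub_le_of_norm_fderiv_le' (𝕜 := ℝ) (f := χ) (C := C * ‖h‖)
      (s := Metric.closedBall z ‖h‖) (x := z) (y := z + h) (φ := fderiv ℝ χ z)
      (fun x _ => (hχ.differentiable (by norm_num)) x) (fun x hx => ?_)
      (convex_closedBall _ _) (Metric.mem_closedBall_self (norm_nonneg _)) (by simp)
    · rw [add_sub_cancel_left, Real.norm_eq_abs] at this
      linarith
    · have h1 := hC.dist_le_mul x z
      rw [dist_eq_norm] at h1
      exact h1.trans (mul_le_mul_of_nonneg_left hx C.coe_nonneg)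
  refine ⟨2 * C, by positivity, fun z h => ?_⟩
  have h1 := abs_le.1 (key z h)
  have h2 := key z (-h)
  rw [norm_neg, ← sub_eq_add_neg, map_neg] at h2
  have h2 := abs_le.1 h2
  rw [abs_le]
  constructor <;> linarith [h1.1, h1.2, h2.1, h2.2]

/-- Convolution with a Landau kernel: a compactly supported continuous function can be averaged
against a kernel that concentrates at the origin so that the result is a polynomial. -/
theorem exists_polynomial_eq_average {n : ℕ} {G : (Fin n → ℝ) → ℝ} (hG : Continuous G) {R : ℝ}
    (hR : 0 ≤ R) (hsupp : ∀ y, R < ‖y‖ → G y = 0) {ρ : ℝ} (hρ : 0 ≤ ρ) {η : ℝ} (hη : 0 < η) :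
    ∃ (P : MvPolynomial (Fin n) ℝ) (S : Set (Fin n → ℝ)) (w : (Fin n → ℝ) → ℝ),
      IsCompact S ∧ Continuous w ∧ (∀ t ∈ S, 0 ≤ w t) ∧ (∫ t in S, w t) = 1 ∧
      (∫ t in S, w t * ‖t‖) ≤ η ∧
      ∀ x, ‖x‖ ≤ ρ → MvPolynomial.eval x P = ∫ t in S, w t * G (x - t) := by
  -- Since `r > R + ρ`, `G (x - t)` vanishes for `‖x‖ ≤ ρ` and `t` outside the ball `S`, so the
  -- integral over `S` is the full convolution.
  set r := R + ρ + 1 with hr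
  have hr0 : 0 < r := by positivity
  -- This scale keeps the base `c` of the kernel nonnegative on `S`.
  set κ : ℝ := (n * r ^ 2 + 1)⁻¹ with hκ
  have hκ0 : 0 < κ := by positivity
  set c : (Fin n → ℝ) → ℝ := fun t => 1 - κ * ∑ i, t i ^ 2 with hc
  have hcc : Continuous c := by fun_prop
  set S := Metric.closedBall (0 : Fin n → ℝ) r with hS
  have hSc : IsCompact S := isCompact_closedBall _ _
  have hc0 : c 0 = 1 := by simp [hc]
  have hcS : ∀ t ∈ S, 0 ≤ c t := fun t ht => by
    have h1 : ∑ i, t i ^ 2 ≤ n * r ^ 2 := by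
      have : ∀ i ∈ Finset.univ, t i ^ 2 ≤ r ^ 2 := fun i _ => by
        rw [mem_closedBall_zero_iff] at ht
        have := (norm_le_pi_norm t i).trans ht
        rw [Real.norm_eq_abs] at this
        exact sq_le_sq' (abs_le.1 this).1 (abs_le.1 this).2
      simpa using Finset.sum_le_sum this
    have h2 : κ * ∑ i, t i ^ 2 ≤ κ * (n * r ^ 2 + 1) :=
      mul_le_mul_of_nonneg_left (by linarith) hκ0.le
    rw [hκ, inv_mul_cancel₀ (by positivity)] at h2
    simp only [hc]
    linarith
  have hclt : ∀ t ∈ S, t ≠ 0 → c t < c 0 := fun t _ ht => by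
    obtain ⟨i, hi⟩ := Function.ne_iff.1 ht
    have : 0 < ∑ i, t i ^ 2 := Finset.sum_pos' (fun i _ => sq_nonneg _)
      ⟨i, Finset.mem_univ _, by simpa using pow_pos (abs_pos.2 hi) 2⟩
    rw [hc0]
    have := mul_pos hκ0 this
    simp only [hc]
    linarith
  have hpeak : ∀ g : (Fin n → ℝ) → ℝ, Continuous g →
      Filter.Tendsto (fun k : ℕ => (∫ x in S, c x ^ k)⁻¹ • ∫ x in S, c x ^ k • g x)
        Filter.atTop (nhds (g 0)) := fun g hg => by
    refine tendsto_setIntegral_pow_smul_of_unique_maximum_of_isCompact_of_continuousOn hSc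
      hcc.continuousOn hclt hcS (by rw [hc0]; exact one_pos) (subset_closure ?_) hg.continuousOn
    exact mem_interior_iff_mem_nhds.2 (Metric.closedBall_mem_nhds _ hr0)
  obtain ⟨k, hk1, hk2⟩ := (((hpeak (fun _ => 1) continuous_const).eventually
    (lt_mem_nhds (zero_lt_one))).and ((hpeak (fun t => ‖t‖) continuous_norm).eventually
    (gt_mem_nhds (by simpa using hη)))).exists
  set I := ∫ x in S, c x ^ k with hI
  have hI0 : I ≠ 0 := fun h => by simp [h] at hk1
  -- `Φ` is `c (x - y) ^ k` as a polynomial in `x` with coefficients polynomial in `y`; integrating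
  -- the coefficients against `G` leaves a polynomial in `x`.
  set Φ : MvPolynomial (Fin n) (MvPolynomial (Fin n) ℝ) :=
    (1 - MvPolynomial.C (MvPolynomial.C κ) *
      ∑ i, (MvPolynomial.X i - MvPolynomial.C (MvPolynomial.X i)) ^ 2) ^ k with hΦ
  have hΦe : ∀ x y, ∑ s ∈ Φ.support, MvPolynomial.eval y (Φ.coeff s) * ∏ i, x i ^ s i =
      c (x - y) ^ k := fun x y => by
    rw [← MvPolynomial.eval₂_eq', ← MvPolynomial.eval_map]
    simp [hΦ, hc]
  have hGs : HasCompactSupport G := by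
    refine HasCompactSupport.intro (isCompact_closedBall (0 : Fin n → ℝ) R) fun y hy => ?_
    exact hsupp y (by simpa using hy)
  refine ⟨∑ s ∈ Φ.support, MvPolynomial.monomial s
    (I⁻¹ * ∫ y, G y * MvPolynomial.eval y (Φ.coeff s)), S, fun t => I⁻¹ * c t ^ k, hSc,
    by fun_prop, fun t ht => ?_, ?_, ?_, fun x hx => ?_⟩
  · refine mul_nonneg (inv_nonneg.2 ?_) (pow_nonneg (hcS t ht) _)
    exact setIntegral_nonneg hSc.measurableSet fun t ht => pow_nonneg (hcS t ht) _
  · rw [integral_const_mul, inv_mul_cancel₀ hI0]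
  · simp only [mul_assoc, integral_const_mul]
    exact hk2.le
  · have h1 : MvPolynomial.eval x (∑ s ∈ Φ.support, MvPolynomial.monomial s
        (I⁻¹ * ∫ y, G y * MvPolynomial.eval y (Φ.coeff s))) =
        I⁻¹ * ∫ y, G y * c (x - y) ^ k := by
      simp only [map_sum, MvPolynomial.eval_monomial, Finsupp.prod_fintype, pow_zero, implies_true,
        mul_assoc, ← Finset.mul_sum]
      congr 1
      simp only [← hΦe, Finset.mul_sum]
      rw [integral_finsetSum]
      · refine Finset.sum_congr rfl fun s _ => ?_
        rw [← integral_mul_const]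
        simp only [mul_assoc]
      · intro s _
        refine Continuous.integrable_of_hasCompactSupport ?_ hGs.mul_right
        exact hG.mul ((MvPolynomial.continuous_eval _).mul continuous_const)
    rw [h1, ← integral_sub_left_eq_self _ _ x]
    simp only [sub_sub_cancel, mul_assoc, integral_const_mul]
    congr 1
    rw [setIntegral_eq_integral_of_forall_compl_eq_zero]
    · exact integral_congr_ae (.of_forall fun t => mul_comm _ _)
    · intro t ht
      rw [hsupp, mul_zero]
      have h2 : r < ‖t‖ := by simpa [hS] using ht
      have h3 := norm_sub_norm_le t x
      rw [norm_sub_rev] at h3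
      linarith

/-- Extend `f` to a convex Lipschitz `F`, cut it off far from the box, and average against a
polynomial kernel. The cutoff destroys convexity only at distance greater than 1 from the box, where
the kernel has little mass, so second differences are at least `-2ε‖h‖²`; adding `ε ∑ x k ^ 2`
repairs them. -/
theorem exists_convex_polynomial_near {n : ℕ} {l u : Fin n → ℝ} {f : (Fin n → ℝ) → ℝ} {K : NNReal}
    (hf : LipschitzOnWith K f (Set.Icc l u)) (hc : ConvexOn ℝ (Set.Icc l u) f) {δ : ℝ}
    (hδ : 0 < δ) :
    ∃ P : MvPolynomial (Fin n) ℝ, (∀ x ∈ Set.Icc l u, (polyHessian P x).PosSemidef) ∧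
      ∀ x ∈ Set.Icc l u, |MvPolynomial.eval x P - f x| ≤ δ := by
  rcases (Set.Icc l u).eq_empty_or_nonempty with he | hne
  · exact ⟨0, by simp [he], by simp [he]⟩
  obtain ⟨F, hFl, hFc, hFf⟩ := hf.exists_convex_extension hne hc
  obtain ⟨R, hR0, hR⟩ := (isCompact_Icc (a := l) (b := u)).isBounded.exists_pos_norm_le
  set χ : ContDiffBump (0 : Fin n → ℝ) := ⟨R + 3, R + 4, by linarith, by linarith⟩ with hχ
  have hχ1 : ∀ z : Fin n → ℝ, ‖z‖ ≤ R + 3 → χ z = 1 := fun z hz =>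
    χ.one_of_mem_closedBall (by simpa using hz)
  have hχ0 : ∀ z : Fin n → ℝ, R + 4 ≤ ‖z‖ → χ z = 0 := fun z hz =>
    χ.zero_of_le_dist (by simpa using hz)
  have hχd : ContDiff ℝ 2 χ := χ.contDiff
  obtain ⟨M₂, hM₂, hχ2⟩ := hχd.exists_abs_second_difference_le χ.hasCompactSupport
  obtain ⟨M₁, hχl⟩ := hχd.lipschitzWith_of_hasCompactSupport χ.hasCompactSupport (by norm_num)
  set G : (Fin n → ℝ) → ℝ := fun z => F z * χ z with hG
  have hGc : Continuous G := hFl.continuous.mul χ.continuous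
  have hG0 : ∀ z, R + 4 < ‖z‖ → G z = 0 := fun z hz => by simp [hG, hχ0 z hz.le]
  obtain ⟨A, hA⟩ := (isCompact_closedBall (0 : Fin n → ℝ) (R + 5)).exists_bound_of_continuousOn
    hFl.continuous.continuousOn
  have hA' : ∀ z, ‖z‖ ≤ R + 5 → |F z| ≤ A := fun z hz => hA z (by simpa using hz)
  have hA0 : 0 ≤ A := (abs_nonneg _).trans (hA' 0 (by simp; linarith))
  have hFΔ : ∀ z h, 0 ≤ F (z + h) + F (z - h) - 2 * F z := fun z h => by
    have := hFc.2 (Set.mem_univ (z + h)) (Set.mem_univ (z - h))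
      (by norm_num : (0 : ℝ) ≤ 1 / 2) (by norm_num : (0 : ℝ) ≤ 1 / 2) (by norm_num)
    rw [show (1 / 2 : ℝ) • (z + h) + (1 / 2 : ℝ) • (z - h) = z by module] at this
    simp only [smul_eq_mul] at this
    linarith
  have hGB : ∀ z, |G z| ≤ A := fun z => by
    rcases le_or_gt ‖z‖ (R + 5) with hz | hz
    · rw [hG, abs_mul, abs_of_nonneg (χ.nonneg)]
      nlinarith [hA' z hz, χ.le_one (x := z), χ.nonneg (x := z), abs_nonneg (F z)]
    · simpa [hG0 z (by linarith)] using hA0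
  set M := A * M₂ + 2 * (K * M₁) with hM
  have hM0 : 0 ≤ M := by positivity
  -- Leibniz rule for second differences of `F χ`: the term `χ Δ²F` is nonnegative, and the others
  -- are quadratic in `‖h‖` although `F` is merely Lipschitz.
  have hGΔ : ∀ z h, ‖h‖ ≤ 1 → -(M * ‖h‖ ^ 2) ≤ G (z + h) + G (z - h) - 2 * G z := fun z h hh => by
    rcases le_or_gt ‖z‖ (R + 5) with hz | hz
    · have e : G (z + h) + G (z - h) - 2 * G z = χ z * (F (z + h) + F (z - h) - 2 * F z) +
          F z * (χ (z + h) + χ (z - h) - 2 * χ z) + (F (z + h) - F z) * (χ (z + h) - χ z) +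
          (F (z - h) - F z) * (χ (z - h) - χ z) := by simp only [hG]; ring
      have h1 := mul_nonneg (χ.nonneg (x := z)) (hFΔ z h)
      have h2 : |F z * (χ (z + h) + χ (z - h) - 2 * χ z)| ≤ A * (M₂ * ‖h‖ ^ 2) := by
        rw [abs_mul]
        exact mul_le_mul (hA' z hz) (hχ2 z h) (abs_nonneg _) hA0
      have h3 : ∀ v, |(F (z + v) - F z) * (χ (z + v) - χ z)| ≤ (K * ‖v‖) * (M₁ * ‖v‖) := fun v => by
        have a1 := hFl.dist_le_mul (z + v) z
        have a2 := hχl.dist_le_mul (z + v) z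
        rw [dist_eq_norm, dist_eq_norm, add_sub_cancel_left, Real.norm_eq_abs] at a1 a2
        rw [abs_mul]
        exact mul_le_mul a1 a2 (abs_nonneg _) (by positivity)
      have h4 := h3 (-h)
      rw [norm_neg, ← sub_eq_add_neg] at h4
      have h2 := (abs_le.1 h2).1
      have h4 := (abs_le.1 h4).1
      have h3 := (abs_le.1 (h3 h)).1
      rw [e, hM]
      linarith
    · have h1 := norm_sub_norm_le z (-h)
      have h2 := norm_sub_norm_le z h
      rw [norm_neg, sub_neg_eq_add] at h1
      rw [hG0 z (by linarith), hG0 (z + h) (by linarith), hG0 (z - h) (by linarith)]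
      have := mul_nonneg hM0 (sq_nonneg ‖h‖)
      linarith
  have hGF : ∀ z, ‖z‖ ≤ R + 3 → G z = F z := fun z hz => by simp [hG, hχ1 z hz]
  -- For `‖t‖ ≤ 1` only points where `G = F` occur, and `F` is convex; for `‖t‖ > 1` the crude bound
  -- is absorbed by the factor `‖t‖`. The deficit is thus controlled by the first moment of the
  -- kernel.
  have hGΔ' : ∀ x ∈ Set.Icc l u, ∀ h, ‖h‖ ≤ 1 → ∀ t,
      -(M * ‖h‖ ^ 2 * ‖t‖) ≤ G (x + h - t) + G (x - h - t) - 2 * G (x - t) := fun x hx h hh t => by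
    have hxR := hR x hx
    rw [show x + h - t = x - t + h by abel, show x - h - t = x - t - h by abel]
    rcases le_or_gt ‖t‖ 1 with ht | ht
    · have h1 := norm_sub_le x t
      have h2 := norm_add_le (x - t) h
      have h3 := norm_sub_le (x - t) h
      rw [hGF _ (by linarith), hGF _ (by linarith), hGF _ (by linarith)]
      have : 0 ≤ M * ‖h‖ ^ 2 * ‖t‖ := by positivity
      linarith [hFΔ (x - t) h]
    · refine le_trans ?_ (hGΔ (x - t) h hh)
      have : 0 ≤ M * ‖h‖ ^ 2 := by positivity
      nlinarith
  have hGL : ∀ x ∈ Set.Icc l u, ∀ t, |G (x - t) - f x| ≤ (K + 2 * A) * ‖t‖ := fun x hx t => by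
    have hxR := hR x hx
    rw [← hFf hx, ← hGF x (by linarith)]
    rcases le_or_gt ‖t‖ 1 with ht | ht
    · have h1 := norm_sub_le x t
      rw [hGF _ (by linarith), hGF _ (by linarith)]
      have a1 := hFl.dist_le_mul (x - t) x
      rw [dist_eq_norm, dist_eq_norm, Real.norm_eq_abs, sub_sub_cancel_left, norm_neg] at a1
      have : 0 ≤ 2 * A * ‖t‖ := by positivity
      linarith
    · have h1 := abs_sub (G (x - t)) (G x)
      have h2 := hGB (x - t)
      have h3 := hGB x
      have h4 : 0 ≤ (K : ℝ) := K.coe_nonneg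
      nlinarith
  -- The quadratic correction then costs at most `δ / 2` on the box; `η` is chosen so that the
  -- averaging costs the other half and the convexity deficit stays below `2ε`.
  set ε : ℝ := δ / (2 * (n * R ^ 2 + 1)) with hε
  have hε0 : 0 < ε := by positivity
  set η : ℝ := min (2 * ε / (M + 1)) (δ / 2 / (K + 2 * A + 1)) with hη
  have hη0 : 0 < η := lt_min (by positivity) (by positivity)
  have hη1 : M * η ≤ 2 * ε := by
    have h1 : η ≤ 2 * ε / (M + 1) := min_le_left _ _
    rw [le_div_iff₀ (by positivity)] at h1
    linarith
  have hη2 : (K + 2 * A) * η ≤ δ / 2 := by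
    have h1 : η ≤ δ / 2 / (K + 2 * A + 1) := min_le_right _ _
    rw [le_div_iff₀ (by positivity)] at h1
    linarith
  obtain ⟨P, S, w, hS, hw, hw0, hw1, hwη, hP⟩ := exists_polynomial_eq_average hGc
    (by linarith : 0 ≤ R + 4) hG0 (by linarith : 0 ≤ R + 1) hη0
  have hint : ∀ φ : (Fin n → ℝ) → ℝ, Continuous φ → IntegrableOn (fun t => w t * φ t) S :=
    fun φ hφ => (hw.mul hφ).continuousOn.integrableOn_compact hS
  have hmono : ∀ φ ψ : (Fin n → ℝ) → ℝ, Continuous φ → Continuous ψ → (∀ t, φ t ≤ ψ t) →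
      (∫ t in S, w t * φ t) ≤ ∫ t in S, w t * ψ t := fun φ ψ hφ hψ h =>
    setIntegral_mono_on (hint φ hφ) (hint ψ hψ) hS.measurableSet fun t ht =>
      mul_le_mul_of_nonneg_left (h t) (hw0 t ht)
  have hGx : ∀ x, Continuous fun t => G (x - t) := fun x => hGc.comp (by fun_prop)
  have hPa : ∀ x ∈ Set.Icc l u, |MvPolynomial.eval x P - f x| ≤ δ / 2 := fun x hx => by
    rw [hP x (by linarith [hR x hx])]
    have e : ∫ t in S, w t * f x = f x := by rw [integral_mul_const, hw1, one_mul]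
    have e' : ∀ L : ℝ, ∫ t in S, w t * (L * ‖t‖) = L * ∫ t in S, w t * ‖t‖ := fun L => by
      rw [← integral_const_mul]
      exact integral_congr_ae (.of_forall fun t => by ring)
    have h1 := hmono (fun t => G (x - t) - f x) (fun t => (K + 2 * A) * ‖t‖)
      ((hGx x).sub continuous_const) (by fun_prop) fun t => (abs_le.1 (hGL x hx t)).2
    have h2 := hmono (fun t => (-(K + 2 * A)) * ‖t‖) (fun t => G (x - t) - f x)
      (by fun_prop) ((hGx x).sub continuous_const) fun t => by
        linarith [(abs_le.1 (hGL x hx t)).1]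
    have e2 : ∫ t in S, w t * (G (x - t) - f x) = (∫ t in S, w t * G (x - t)) - f x := by
      simp only [mul_sub]
      rw [integral_sub (hint _ (hGx x)) (hint _ continuous_const), e]
    rw [e', e2] at h1 h2
    have : (K + 2 * A) * (∫ t in S, w t * ‖t‖) ≤ (K + 2 * A) * η :=
      mul_le_mul_of_nonneg_left hwη (by positivity)
    rw [abs_le]
    constructor <;> linarith
  refine ⟨P + MvPolynomial.C ε * ∑ k, MvPolynomial.X k ^ 2, fun x hx => ?_, fun x hx => ?_⟩
  · refine polyHessian_posSemidef_of_second_difference fun h hh => ?_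
    have hxR := hR x hx
    simp only [map_add, map_mul, MvPolynomial.eval_C, map_sum, map_pow, MvPolynomial.eval_X]
    have hq : ε * ∑ k, (x + h) k ^ 2 + ε * ∑ k, (x - h) k ^ 2 - 2 * (ε * ∑ k, x k ^ 2) =
        2 * ε * ∑ k, h k ^ 2 := by
      simp only [Finset.mul_sum, ← Finset.sum_add_distrib, ← Finset.sum_sub_distrib]
      exact Finset.sum_congr rfl fun k _ => by simp only [Pi.add_apply, Pi.sub_apply]; ring
    have hh2 : ‖h‖ ^ 2 ≤ ∑ k, h k ^ 2 := by
      have h0 : 0 ≤ ∑ k, h k ^ 2 := Finset.sum_nonneg fun _ _ => sq_nonneg _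
      rw [← Real.le_sqrt (norm_nonneg _) h0, pi_norm_le_iff_of_nonneg (Real.sqrt_nonneg _)]
      intro k
      rw [Real.norm_eq_abs]
      exact Real.abs_le_sqrt (Finset.single_le_sum (f := fun k => h k ^ 2)
        (fun _ _ => sq_nonneg _) (Finset.mem_univ k))
    have hPΔ : -(2 * ε * ‖h‖ ^ 2) ≤ MvPolynomial.eval (x + h) P + MvPolynomial.eval (x - h) P -
        2 * MvPolynomial.eval x P := by
      rw [hP _ (by linarith [norm_add_le x h]), hP _ (by linarith [norm_sub_le x h]),
        hP _ (by linarith)]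
      have h1 := hmono (fun t => (-(M * ‖h‖ ^ 2)) * ‖t‖)
        (fun t => G (x + h - t) + G (x - h - t) - 2 * G (x - t)) (by fun_prop)
        (((hGx _).add (hGx _)).sub (continuous_const.mul (hGx _))) fun t => by
          linarith [hGΔ' x hx h hh t]
      have e : ∫ t in S, w t * (G (x + h - t) + G (x - h - t) - 2 * G (x - t)) =
          (∫ t in S, w t * G (x + h - t)) + (∫ t in S, w t * G (x - h - t)) -
            2 * ∫ t in S, w t * G (x - t) := by
        have i1 := (hint _ (hGx (x + h))).add (hint _ (hGx (x - h)))
        have i2 := (hint _ (hGx x)).const_mul 2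
        rw [← integral_add (hint _ (hGx _)) (hint _ (hGx _)), ← integral_const_mul]
        refine Eq.trans ?_ (integral_sub i1 i2)
        exact integral_congr_ae (.of_forall fun t => by ring)
      have e' : ∫ t in S, w t * ((-(M * ‖h‖ ^ 2)) * ‖t‖) =
          -(M * ‖h‖ ^ 2) * ∫ t in S, w t * ‖t‖ := by
        rw [← integral_const_mul]
        exact integral_congr_ae (.of_forall fun t => by ring)
      rw [e, e'] at h1
      have h2 : M * ‖h‖ ^ 2 * (∫ t in S, w t * ‖t‖) ≤ M * ‖h‖ ^ 2 * η :=
        mul_le_mul_of_nonneg_left hwη (by positivity)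
      have h3 : ‖h‖ ^ 2 * (M * η) ≤ ‖h‖ ^ 2 * (2 * ε) :=
        mul_le_mul_of_nonneg_left hη1 (sq_nonneg _)
      linarith
    have := mul_le_mul_of_nonneg_left hh2 (by positivity : 0 ≤ 2 * ε)
    linarith
  · have hxR := hR x hx
    simp only [map_add, map_mul, MvPolynomial.eval_C, map_sum, map_pow, MvPolynomial.eval_X]
    have h1 : ∑ k, x k ^ 2 ≤ n * R ^ 2 := by
      have : ∀ k ∈ Finset.univ, x k ^ 2 ≤ R ^ 2 := fun k _ => by
        have := (norm_le_pi_norm x k).trans hxR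
        rw [Real.norm_eq_abs] at this
        exact sq_le_sq' (abs_le.1 this).1 (abs_le.1 this).2
      simpa using Finset.sum_le_sum this
    have h2 : ε * ∑ k, x k ^ 2 ≤ ε * (n * R ^ 2 + 1) :=
      mul_le_mul_of_nonneg_left (by linarith) hε0.le
    have h3 : ε * (n * R ^ 2 + 1) = δ / 2 := by rw [hε]; field_simp
    have h4 : 0 ≤ ε * ∑ k, x k ^ 2 :=
      mul_nonneg hε0.le (Finset.sum_nonneg fun _ _ => sq_nonneg _)
    have h5 := abs_le.1 (hPa x hx)
    rw [abs_le]
    constructor <;> linarith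

/-! ### Inner boxes, and bounds for convex functions from few points -/

/-- The box `[l, u]` shrunk by the proportion `t` of its side lengths at each face. -/
def innerBox {n : ℕ} (l u : Fin n → ℝ) (t : ℝ) : Set (Fin n → ℝ) :=
  Set.Icc (l + t • (u - l)) (u - t • (u - l))

/-- Open boxes near the corners (`some σ`) and the center (`none`) of `[l, u]`. -/
def anchorBox {n : ℕ} (l u : Fin n → ℝ) (t : ℝ) : Option (Fin n → Bool) → Set (Fin n → ℝ)
  | some σ => Set.univ.pi fun k => if σ k then Set.Ioo (u k - t * (u k - l k)) (u k)
      else Set.Ioo (l k) (l k + t * (u k - l k))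
  | none => Set.univ.pi fun k => Set.Ioo ((l k + u k) / 2 - (u k - l k) / 8)
      ((l k + u k) / 2 + (u k - l k) / 8)

section Box

variable {n : ℕ} {l u : Fin n → ℝ}

theorem mem_innerBox {t : ℝ} {x : Fin n → ℝ} : x ∈ innerBox l u t ↔
    ∀ k, l k + t * (u k - l k) ≤ x k ∧ x k ≤ u k - t * (u k - l k) := by
  simp [innerBox, Set.mem_Icc, Pi.le_def, forall_and]

theorem mem_box_iff {x : Fin n → ℝ} : x ∈ Set.Icc l u ↔ ∀ k, l k ≤ x k ∧ x k ≤ u k := by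
  simp [Set.mem_Icc, Pi.le_def, forall_and]

theorem isOpen_anchorBox (t : ℝ) (a : Option (Fin n → Bool)) : IsOpen (anchorBox l u t a) := by
  cases a with
  | none => exact isOpen_set_pi Set.finite_univ fun k _ => isOpen_Ioo
  | some σ =>
    refine isOpen_set_pi Set.finite_univ fun k _ => ?_
    split_ifs <;> exact isOpen_Ioo

theorem anchorBox_subset (hlu : ∀ k, l k < u k) {t : ℝ} (ht : t ≤ 1)
    (a : Option (Fin n → Bool)) : anchorBox l u t a ⊆ Set.Icc l u := by
  intro x hx
  rw [mem_box_iff]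
  intro k
  have hk := sub_pos.2 (hlu k)
  cases a with
  | none =>
    have h := hx k (Set.mem_univ k)
    exact ⟨by linarith [h.1], by linarith [h.2]⟩
  | some σ =>
    have h := hx k (Set.mem_univ k)
    dsimp only at h
    split_ifs at h
    · exact ⟨by nlinarith [h.1], h.2.le⟩
    · exact ⟨h.1.le, by nlinarith [h.2]⟩

theorem anchorBox_nonempty (hlu : ∀ k, l k < u k) {t : ℝ} (ht : 0 < t)
    (a : Option (Fin n → Bool)) : (anchorBox l u t a).Nonempty := by
  cases a with
  | none =>
    refine Set.univ_pi_nonempty_iff.2 fun k => ?_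
    have hk := sub_pos.2 (hlu k)
    exact Set.nonempty_Ioo.2 (by linarith)
  | some σ =>
    refine Set.univ_pi_nonempty_iff.2 fun k => ?_
    have hk := mul_pos ht (sub_pos.2 (hlu k))
    split_ifs <;> exact Set.nonempty_Ioo.2 (by linarith)

theorem innerBox_subset (hlu : ∀ k, l k < u k) {s t : ℝ} (hst : s ≤ t) :
    innerBox l u t ⊆ innerBox l u s := by
  intro x hx
  rw [mem_innerBox] at hx ⊢
  intro k
  have hk := mul_le_mul_of_nonneg_right hst (sub_pos.2 (hlu k)).le
  exact ⟨by linarith [(hx k).1], by linarith [(hx k).2]⟩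

theorem innerBox_zero : innerBox l u 0 = Set.Icc l u := by simp [innerBox]

theorem innerBox_subset_box (hlu : ∀ k, l k < u k) {t : ℝ} (ht : 0 ≤ t) :
    innerBox l u t ⊆ Set.Icc l u := by
  rw [← innerBox_zero]
  exact innerBox_subset hlu ht

theorem exists_closedBall_subset_innerBox (hlu : ∀ k, l k < u k) {s t : ℝ} (hst : s < t) :
    ∃ r > 0, ∀ x ∈ innerBox l u t, Metric.closedBall x r ⊆ innerBox l u s := by
  obtain ⟨w, hw0, hw⟩ : ∃ w > 0, ∀ k, w ≤ u k - l k := by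
    rcases isEmpty_or_nonempty (Fin n) with h | h
    · exact ⟨1, one_pos, fun k => h.elim k⟩
    · obtain ⟨k, hk⟩ := Finite.exists_min fun k => u k - l k
      exact ⟨_, sub_pos.2 (hlu k), hk⟩
  refine ⟨(t - s) * w, mul_pos (sub_pos.2 hst) hw0, fun x hx y hy => ?_⟩
  rw [mem_innerBox] at hx ⊢
  intro k
  have h1 := (norm_le_pi_norm (y - x) k).trans (by simpa [dist_eq_norm] using hy)
  have h1 := abs_le.1 h1
  simp only [Pi.sub_apply] at h1
  have h2 := mul_le_mul_of_nonneg_left (hw k) (sub_pos.2 hst).le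
  exact ⟨by linarith [(hx k).1], by linarith [(hx k).2]⟩

theorem interior_innerBox_nonempty (hlu : ∀ k, l k < u k) {t : ℝ} (ht : t < 1 / 2) :
    (interior (innerBox l u t)).Nonempty := by
  refine ⟨fun k => (l k + u k) / 2, ?_⟩
  rw [mem_interior_iff_mem_nhds]
  have hmem : (fun k => (l k + u k) / 2) ∈ innerBox l u (1 / 2) := by
    rw [mem_innerBox]
    intro k
    have := hlu k
    constructor <;> linarith
  obtain ⟨r, hr, hrs⟩ := exists_closedBall_subset_innerBox hlu ht
  exact Filter.mem_of_superset (Metric.closedBall_mem_nhds _ hr) (hrs _ hmem)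

theorem IsCompact.exists_subset_innerBox (hlu : ∀ k, l k < u k) {C : Set (Fin n → ℝ)}
    (hC : IsCompact C) (hCB : C ⊆ interior (Set.Icc l u)) :
    ∃ t > 0, C ⊆ innerBox l u t := by
  obtain ⟨r, hr0, hr⟩ := hC.exists_cthickening_subset_open isOpen_interior hCB
  have hW : 0 ≤ ∑ k, (u k - l k) := Finset.sum_nonneg fun k _ => (sub_pos.2 (hlu k)).le
  refine ⟨r / (1 + ∑ k, (u k - l k)), by positivity, fun x hx => ?_⟩
  rw [mem_innerBox]
  intro k
  have hb : ∀ v : Fin n → ℝ, ‖v‖ ≤ r → x + v ∈ Set.Icc l u := fun v hv =>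
    interior_subset (hr (Metric.mem_cthickening_of_dist_le _ x _ _ hx (by simpa using hv)))
  have hn : ‖fun _ : Fin n => r‖ ≤ r :=
    (pi_norm_le_iff_of_nonneg hr0.le).2 fun _ => by simp [abs_of_pos hr0]
  have h1 := (mem_box_iff.1 (hb (fun _ => r) hn) k).2
  have h2 := (mem_box_iff.1 (hb (-fun _ => r) (by rwa [norm_neg])) k).1
  have h3 : u k - l k ≤ ∑ k, (u k - l k) := Finset.single_le_sum (f := fun k => u k - l k)
    (fun k _ => (sub_pos.2 (hlu k)).le) (Finset.mem_univ k)
  have h4 : r / (1 + ∑ k, (u k - l k)) * (u k - l k) ≤ r := by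
    rw [div_mul_eq_mul_div, div_le_iff₀ (by positivity)]
    exact mul_le_mul_of_nonneg_left (by linarith) hr0.le
  simp only [Pi.add_apply, Pi.neg_apply] at h1 h2
  exact ⟨by linarith, by linarith⟩

/-- A functional separating `z` from the hull is beaten at the corner selected by the signs of its
coefficients. -/
theorem mem_convexHull_of_mem_corner_anchorBox {t : ℝ} {p : (Fin n → Bool) → Fin n → ℝ}
    (hp : ∀ σ, p σ ∈ anchorBox l u t (some σ)) {z : Fin n → ℝ} (hz : z ∈ innerBox l u t) :
    z ∈ convexHull ℝ (Set.range p) := by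
  by_contra hcon
  obtain ⟨φ, c, h1, h2⟩ := geometric_hahn_banach_closed_point (convex_convexHull ℝ _)
    ((Set.finite_range p).isClosed_convexHull ℝ) hcon
  rw [mem_innerBox] at hz
  set e : Fin n → ℝ := fun k => φ (fun j => if k = j then 1 else 0) with he
  have hφ : ∀ x, φ x = ∑ k, x k * e k := fun x => by
    simpa using LinearMap.pi_apply_eq_sum_univ (φ : (Fin n → ℝ) →ₗ[ℝ] ℝ) x
  set σ : Fin n → Bool := fun k => decide (0 ≤ e k) with hσ
  have h3 := h1 _ (subset_convexHull ℝ _ ⟨σ, rfl⟩)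
  have h4 : φ z ≤ φ (p σ) := by
    rw [hφ, hφ]
    refine Finset.sum_le_sum fun k _ => ?_
    have hk := hp σ k (Set.mem_univ k)
    by_cases hek : 0 ≤ e k
    · simp only [hσ, hek, decide_true, if_true] at hk
      exact mul_le_mul_of_nonneg_right ((hz k).2.trans hk.1.le) hek
    · simp only [hσ, hek, decide_false, Bool.false_eq_true, if_false] at hk
      exact mul_le_mul_of_nonpos_right (hk.2.le.trans (hz k).1) (not_le.1 hek).le
  linarith

/-- The corner points bound `g` above by `A` on the inner box. For the lower bound, reflect `z`
through the central point `x₀`. -/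
theorem ConvexOn.abs_le_of_anchorBox (hlu : ∀ k, l k < u k) {t : ℝ} (ht0 : 0 ≤ t)
    (ht : t ≤ 1 / 8) {g : (Fin n → ℝ) → ℝ} (hg : ConvexOn ℝ (Set.Icc l u) g) {A : ℝ}
    (h : ∀ a, ∃ x ∈ anchorBox l u t a, |g x| ≤ A) {z : Fin n → ℝ} (hz : z ∈ innerBox l u t) :
    |g z| ≤ 9 * A := by
  choose p hp hpA using h
  have hA : 0 ≤ A := (abs_nonneg _).trans (hpA none)
  have hsub := anchorBox_subset hlu (ht.trans (by norm_num))
  have hupper : ∀ z ∈ innerBox l u t, g z ≤ A := fun z hz => by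
    obtain ⟨_, ⟨σ, rfl⟩, hy⟩ := hg.exists_ge_of_mem_convexHull
      (by rintro _ ⟨σ, rfl⟩; exact hsub _ (hp (some σ)))
      (mem_convexHull_of_mem_corner_anchorBox (fun σ => hp (some σ)) hz)
    exact hy.trans ((le_abs_self _).trans (hpA _))
  set x₀ := p none with hx₀
  -- The factor `1/4` keeps the reflected point `w` in the inner box. As `x₀ = (4/5) w + (1/5) z`,
  -- convexity gives `g z ≥ 5 g x₀ - 4 g w ≥ -9A`.
  have hw : x₀ + (1 / 4 : ℝ) • (x₀ - z) ∈ innerBox l u t := by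
    rw [mem_innerBox] at hz ⊢
    intro k
    have hk := sub_pos.2 (hlu k)
    have h1 := hp none k (Set.mem_univ k)
    simp only [Set.mem_Ioo, ← hx₀] at h1
    have h2 := mul_le_mul_of_nonneg_right ht hk.le
    have h3 := mul_nonneg ht0 hk.le
    have h4 := hz k
    simp only [Pi.add_apply, Pi.smul_apply, Pi.sub_apply, smul_eq_mul]
    constructor <;> linarith
  have h1 := hg.2 (innerBox_subset_box hlu ht0 hw) (innerBox_subset_box hlu ht0 hz)
    (by norm_num : (0 : ℝ) ≤ 4 / 5) (by norm_num : (0 : ℝ) ≤ 1 / 5) (by norm_num)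
  rw [show (4 / 5 : ℝ) • (x₀ + (1 / 4 : ℝ) • (x₀ - z)) + (1 / 5 : ℝ) • z = x₀ by module] at h1
  simp only [smul_eq_mul] at h1
  have h2 := hupper _ hw
  have h3 := hupper _ hz
  have h4 := (abs_le.1 (hpA none)).1
  rw [abs_le]
  constructor <;> linarith

theorem ConvexOn.abs_sub_le_of_abs_le {E : Type*} [NormedAddCommGroup E] [NormedSpace ℝ E]
    {g : E → ℝ} {x y : E} {r M : ℝ} (hr : 0 < r) (hg : ConvexOn ℝ (Metric.ball x (2 * r)) g)
    (hM : ∀ z ∈ Metric.ball x (2 * r), |g z| ≤ M) (hy : ‖y - x‖ < r) :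
    |g y - g x| ≤ 2 * M / r * ‖y - x‖ := by
  have h := hg.lipschitzOnWith_of_abs_le hr fun a ha => hM a ha
  rw [show 2 * r - r = r by ring] at h
  have h1 := h.dist_le_mul y (by simpa [dist_eq_norm] using hy) x (by simpa using hr)
  have hM0 : 0 ≤ M := (abs_nonneg _).trans (hM x (by simpa using hr))
  rwa [Real.dist_eq, dist_eq_norm, Real.coe_toNNReal _ (by positivity)] at h1

end Box

/-! ### The finite-dimensional cone of convex polynomials -/

section Finite

open MvPolynomial

variable {n : ℕ}

/-- Coordinates on the space of polynomials of degree at most `d`. -/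
noncomputable def polyCoord (n d : ℕ) :
    restrictTotalDegree (Fin n) ℝ d ≃ₗ[ℝ]
      (Fin (Module.finrank ℝ (restrictTotalDegree (Fin n) ℝ d)) → ℝ) :=
  (Module.finBasis ℝ (restrictTotalDegree (Fin n) ℝ d)).equivFun

/-- The grid `x + {0, r / (d + 1), …, d r / (d + 1)}ⁿ` on which a polynomial of degree at most `d`
is determined by its values. -/
noncomputable def evalGrid (d : ℕ) (x : Fin n → ℝ) (r : ℝ) : Finset (Fin n → ℝ) :=
  Fintype.piFinset fun k => (Finset.range (d + 1)).image fun j : ℕ => x k + r * (j / (d + 1))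

theorem evalGrid_subset {d : ℕ} {x : Fin n → ℝ} {r : ℝ} (hr : 0 ≤ r) {y : Fin n → ℝ}
    (hy : y ∈ evalGrid d x r) : y ∈ Metric.closedBall x r := by
  rw [Metric.mem_closedBall, dist_eq_norm, pi_norm_le_iff_of_nonneg hr]
  intro k
  obtain ⟨j, hj, hjk⟩ := Finset.mem_image.1 (Fintype.mem_piFinset.1 hy k)
  rw [Pi.sub_apply, ← hjk, add_sub_cancel_left, Real.norm_eq_abs, abs_of_nonneg (by positivity)]
  refine mul_le_of_le_one_right hr ?_
  rw [div_le_one (by positivity)]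
  have : j < d + 1 := Finset.mem_range.1 hj
  exact_mod_cast this.le

theorem eq_zero_of_eval_evalGrid {d : ℕ} {x : Fin n → ℝ} {r : ℝ} (hr : 0 < r)
    {g : MvPolynomial (Fin n) ℝ} (hg : g.totalDegree ≤ d)
    (h : ∀ y ∈ evalGrid d x r, eval y g = 0) : g = 0 := by
  refine eq_zero_of_eval_zero_at_prod_finset g (fun k => (Finset.range (d + 1)).image
    fun j : ℕ => x k + r * (j / (d + 1))) (fun k => ?_) fun y hy =>
      h y (Fintype.mem_piFinset.2 hy)
  rw [Finset.card_image_of_injective, Finset.card_range]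
  · exact Nat.lt_succ_of_le ((degreeOf_le_totalDegree g k).trans hg)
  · intro i j hij
    have h1 : (d : ℝ) + 1 ≠ 0 := by positivity
    have := mul_left_cancel₀ hr.ne' (add_left_cancel hij)
    field_simp at this
    exact_mod_cast this

/-- Evaluation on a grid inside `K` is an injective linear map on a finite-dimensional space, hence
antilipschitz. -/
theorem exists_polyCoord_bound (d : ℕ) {K : Set (Fin n → ℝ)} (hK : (interior K).Nonempty) :
    ∃ A : ℝ, 0 ≤ A ∧ ∀ (g : restrictTotalDegree (Fin n) ℝ d) (M : ℝ),
      (∀ x ∈ K, |eval x (g : MvPolynomial (Fin n) ℝ)| ≤ M) → ‖polyCoord n d g‖ ≤ A * M := by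
  obtain ⟨x, hx⟩ := hK
  obtain ⟨r, hr, hrK⟩ := Metric.nhds_basis_closedBall.mem_iff.1 (mem_interior_iff_mem_nhds.1 hx)
  set T : restrictTotalDegree (Fin n) ℝ d →ₗ[ℝ] (evalGrid d x r → ℝ) :=
    LinearMap.pi fun y => ((aeval (R := ℝ) (y : Fin n → ℝ)).toLinearMap).comp
      (Submodule.subtype _) with hT
  have hTe : ∀ g y, T g y = eval (y : Fin n → ℝ) (g : MvPolynomial (Fin n) ℝ) := fun g y => by
    rw [← coe_aeval_eq_eval]
    rfl
  have hker : (T ∘ₗ (polyCoord n d).symm.toLinearMap).ker = ⊥ := by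
    refine LinearMap.ker_eq_bot'.2 fun a ha => ?_
    have : (polyCoord n d).symm a = 0 := by
      refine Subtype.ext (eq_zero_of_eval_evalGrid (x := x) hr
        ((mem_restrictTotalDegree _ _ _).1 ((polyCoord n d).symm a).2) fun y hy => ?_)
      rw [← hTe _ ⟨y, hy⟩]
      exact congrFun ha ⟨y, hy⟩
    simpa using this
  obtain ⟨A, -, hA⟩ := LinearMap.exists_antilipschitzWith _ hker
  refine ⟨A, A.2, fun g M hg => ?_⟩
  have hM : 0 ≤ M := (abs_nonneg _).trans (hg x (interior_subset hx))
  have h1 := hA.le_mul_dist (polyCoord n d g) 0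
  simp only [dist_zero_right, map_zero, LinearMap.comp_apply, LinearEquiv.coe_coe,
    LinearEquiv.symm_apply_apply] at h1
  refine h1.trans (mul_le_mul_of_nonneg_left ?_ A.2)
  refine (pi_norm_le_iff_of_nonneg hM).2 fun y => ?_
  rw [hTe, Real.norm_eq_abs]
  exact hg _ (hrK (evalGrid_subset hr.le y.2))

/-- The quadratic form of the Hessian at `x`, evaluated at `v`, as a functional of the
polynomial. -/
noncomputable def hessianForm (x v : Fin n → ℝ) : MvPolynomial (Fin n) ℝ →ₗ[ℝ] ℝ where
  toFun g := v ⬝ᵥ (polyHessian g x).mulVec v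
  map_add' g h := by
    have : polyHessian (g + h) x = polyHessian g x + polyHessian h x := by
      ext i j
      simp [polyHessian]
    rw [this, Matrix.add_mulVec, dotProduct_add]
  map_smul' c g := by
    have : polyHessian (c • g) x = c • polyHessian g x := by
      ext i j
      simp [polyHessian]
    rw [this, Matrix.smul_mulVec, dotProduct_smul, RingHom.id_apply]

theorem posSemidef_polyHessian_iff {g : MvPolynomial (Fin n) ℝ} {x : Fin n → ℝ} :
    (polyHessian g x).PosSemidef ↔ ∀ v, 0 ≤ hessianForm x v g := by
  refine ⟨fun h v => by simpa [hessianForm] using h.dotProduct_mulVec_nonneg v, fun h => ?_⟩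
  refine Matrix.PosSemidef.of_dotProduct_mulVec_nonneg ?_ fun v => by
    simpa [hessianForm] using h v
  ext i j
  simp [polyHessian, Matrix.conjTranspose, pderiv_pderiv_comm i j]

theorem mem_convexPolys_iff {l u : Fin n → ℝ} {d : ℕ} {g : MvPolynomial (Fin n) ℝ} :
    g ∈ convexPolys l u d ↔ g ∈ restrictTotalDegree (Fin n) ℝ d ∧
      ∀ x ∈ Set.Icc l u, ∀ v, 0 ≤ hessianForm x v g := by
  simp only [convexPolys, Set.mem_ofPred_eq, mem_restrictTotalDegree, posSemidef_polyHessian_iff]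

theorem convex_convexPolys (l u : Fin n → ℝ) (d : ℕ) : Convex ℝ (convexPolys l u d) := by
  intro g hg h hh a b ha hb _
  rw [mem_convexPolys_iff] at hg hh ⊢
  refine ⟨add_mem (Submodule.smul_mem _ a hg.1) (Submodule.smul_mem _ b hh.1), fun x hx v => ?_⟩
  rw [map_add, map_smul, map_smul]
  exact add_nonneg (mul_nonneg ha (hg.2 x hx v)) (mul_nonneg hb (hh.2 x hx v))

theorem zero_mem_convexPolys (l u : Fin n → ℝ) (d : ℕ) :
    (0 : MvPolynomial (Fin n) ℝ) ∈ convexPolys l u d :=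
  mem_convexPolys_iff.2 ⟨zero_mem _, fun x _ v => by simp⟩

theorem convexOn_of_mem_convexPolys {l u : Fin n → ℝ} {d : ℕ} {g : MvPolynomial (Fin n) ℝ}
    (hg : g ∈ convexPolys l u d) : ConvexOn ℝ (Set.Icc l u) fun x => eval x g :=
  convexOn_eval_of_posSemidef (convex_Icc l u) hg.2

end Finite

/-! ### Regular samples: a priori bounds and existence of regressors -/

theorem eventually_le_mul_of_tendsto_div {S : ℕ → ℝ} {L c : ℝ}
    (h : Filter.Tendsto (fun m : ℕ => S m / m) Filter.atTop (nhds L)) (hc : L < c) :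
    ∀ᶠ m : ℕ in Filter.atTop, S m ≤ c * m := by
  filter_upwards [h.eventually (gt_mem_nhds hc), Filter.eventually_gt_atTop 0] with m hm h0
  have h0 : (0 : ℝ) < m := by exact_mod_cast h0
  exact ((div_lt_iff₀ h0).1 hm).le

/-- The deterministic properties of the data sequence `(x i, y i)`, with noises `ν i`, on which
consistency of the convex polynomial regressors rests. -/
structure RegularSample {n : ℕ} (l u : Fin n → ℝ) (f : (Fin n → ℝ) → ℝ) (x : ℕ → Fin n → ℝ)
    (y ν : ℕ → ℝ) : Prop where
  mem : ∀ i, x i ∈ Set.Icc l u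
  eq : ∀ i, y i = f (x i) + ν i
  freq : ∀ O : Set (Fin n → ℝ), IsOpen O → (O ∩ interior (Set.Icc l u)).Nonempty →
    ∃ p > 0, ∀ᶠ m : ℕ in Filter.atTop,
      p * (m : ℝ) ≤ ∑ i ∈ Finset.range m, O.indicator (fun _ => (1 : ℝ)) (x i)
  sq : ∃ V, Filter.Tendsto (fun m : ℕ => (∑ i ∈ Finset.range m, ν i ^ 2) / m) Filter.atTop (nhds V)
  poly : ∀ p : MvPolynomial (Fin n) ℝ, Filter.Tendsto
    (fun m : ℕ => (∑ i ∈ Finset.range m, ν i * MvPolynomial.eval (x i) p) / m) Filter.atTop (nhds 0)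
  cell : ∀ (N : ℕ) (z : Fin n → ℤ), Filter.Tendsto
    (fun m : ℕ => (∑ i ∈ Finset.range m, if (fun k => ⌊N * x i k⌋) = z then ν i else 0) / m)
      Filter.atTop (nhds 0)

namespace RegularSample

variable {n : ℕ} {l u : Fin n → ℝ} {f : (Fin n → ℝ) → ℝ} {x : ℕ → Fin n → ℝ} {y ν : ℕ → ℝ}

theorem exists_freq_of_finite (hs : RegularSample l u f x y ν) {ι : Type*} [Finite ι]
    {O : ι → Set (Fin n → ℝ)} (hO : ∀ j, IsOpen (O j))
    (hO' : ∀ j, (O j ∩ interior (Set.Icc l u)).Nonempty) :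
    ∃ p > 0, ∀ᶠ m : ℕ in Filter.atTop, ∀ j,
      p * (m : ℝ) ≤ ∑ i ∈ Finset.range m, (O j).indicator (fun _ => (1 : ℝ)) (x i) := by
  choose p hp hpm using fun j => hs.freq (O j) (hO j) (hO' j)
  obtain ⟨q, hq0, hq⟩ : ∃ q > 0, ∀ j, q ≤ p j := by
    rcases isEmpty_or_nonempty ι with h | h
    · exact ⟨1, one_pos, fun j => h.elim j⟩
    · obtain ⟨j, hj⟩ := Finite.exists_min p
      exact ⟨_, hp j, hj⟩
  refine ⟨q, hq0, ?_⟩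
  filter_upwards [Filter.eventually_all.2 hpm] with m hm j
  exact (mul_le_mul_of_nonneg_right (hq j) m.cast_nonneg).trans (hm j)

theorem mul_le_sum_of_freq {O : Set (Fin n → ℝ)} {p c : ℝ} {m : ℕ} (hc : 0 ≤ c)
    (hp : p * (m : ℝ) ≤ ∑ i ∈ Finset.range m, O.indicator (fun _ => (1 : ℝ)) (x i))
    {φ : (Fin n → ℝ) → ℝ} (hφ : ∀ z, 0 ≤ φ z)
    (hφc : ∀ i ∈ Finset.range m, x i ∈ O → c ≤ φ (x i)) :
    c * (p * m) ≤ ∑ i ∈ Finset.range m, φ (x i) := by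
  refine (mul_le_mul_of_nonneg_left hp hc).trans ?_
  rw [Finset.mul_sum]
  refine Finset.sum_le_sum fun i hi => ?_
  by_cases h : x i ∈ O
  · simpa [h] using hφc i hi h
  · simpa [h] using hφ _

theorem exists_anchor_freq (hs : RegularSample l u f x y ν) (hlu : ∀ k, l k < u k) {t : ℝ}
    (ht0 : 0 < t) (ht : t ≤ 1) :
    ∃ p > 0, ∀ᶠ m : ℕ in Filter.atTop, ∀ a, p * (m : ℝ) ≤
      ∑ i ∈ Finset.range m, (anchorBox l u t a).indicator (fun _ => (1 : ℝ)) (x i) := by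
  refine hs.exists_freq_of_finite (isOpen_anchorBox t) fun a => ?_
  obtain ⟨z, hz⟩ := anchorBox_nonempty hlu ht0 a
  exact ⟨z, hz, interior_maximal (anchorBox_subset hlu ht a) (isOpen_anchorBox t a) hz⟩

theorem exists_abs_le_on_innerBox (hs : RegularSample l u f x y ν) (hlu : ∀ k, l k < u k) {t : ℝ}
    (ht0 : 0 < t) (ht : t ≤ 1 / 8) {M : ℝ} (hM : 0 ≤ M) :
    ∃ A, 0 ≤ A ∧ ∀ᶠ m : ℕ in Filter.atTop, ∀ g : (Fin n → ℝ) → ℝ, ConvexOn ℝ (Set.Icc l u) g →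
      ∑ i ∈ Finset.range m, g (x i) ^ 2 ≤ M * m → ∀ z ∈ innerBox l u t, |g z| ≤ A := by
  obtain ⟨p, hp0, hp⟩ := hs.exists_anchor_freq hlu ht0 (by linarith)
  -- If `|g| > A₀` at every sample in some anchor box, then `A₀² p ≤ M`, whereas `A₀² p ≥ A₀ p = p +
  -- M`.
  set A₀ := 1 + M / p with hA₀
  have hA₀1 : 1 ≤ A₀ := by
    have : 0 ≤ M / p := by positivity
    linarith
  refine ⟨9 * A₀, by positivity, ?_⟩
  filter_upwards [hp, Filter.eventually_gt_atTop 0] with m hm hm0 g hg hgM z hz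
  refine hg.abs_le_of_anchorBox hlu ht0.le ht (fun a => ?_) hz
  by_contra! hcon
  have h1 := mul_le_sum_of_freq (c := A₀ ^ 2) (by positivity) (hm a) (φ := fun z => g z ^ 2)
    (fun z => sq_nonneg _) fun i _ hi => by
      rw [← sq_abs (g (x i))]
      exact pow_le_pow_left₀ (by positivity) (hcon _ hi).le 2
  have hm0 : (0 : ℝ) < m := by exact_mod_cast hm0
  have h2 : A₀ ^ 2 * p ≤ M := by
    refine le_of_mul_le_mul_right ?_ hm0
    linarith
  have h3 : A₀ * p ≤ A₀ ^ 2 * p := mul_le_mul_of_nonneg_right (by nlinarith) hp0.le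
  have h4 : A₀ * p = p + M := by rw [hA₀]; field_simp
  linarith

/-- It suffices that each anchor box contains a sample, a condition free of `d`. On the sublevel set
of the loss of 0 the values at the samples are bounded, hence so is the polynomial on an inner box
and so are its coordinates; closedness of the cone gives compactness. -/
theorem eventually_exists_regressor (hs : RegularSample l u f x y ν) (hlu : ∀ k, l k < u k) :
    ∀ᶠ m : ℕ in Filter.atTop, ∀ d, ∃ g, IsConvexRegressor l u x y m d g := by
  obtain ⟨p, hp0, hp⟩ := hs.exists_anchor_freq hlu (t := 1 / 8) (by norm_num) (by norm_num)
  filter_upwards [hp, Filter.eventually_gt_atTop 0] with m hm hm0 d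
  have hm0 : (0 : ℝ) < m := by exact_mod_cast hm0
  have hex : ∀ a, ∃ i ∈ Finset.range m, x i ∈ anchorBox l u (1 / 8) a := fun a => by
    by_contra! hcon
    have := hm a
    rw [Finset.sum_eq_zero fun i hi => Set.indicator_of_notMem (hcon i hi) _] at this
    nlinarith [mul_pos hp0 hm0]
  obtain ⟨A, hA0, hA⟩ := exists_polyCoord_bound d
    (interior_innerBox_nonempty hlu (by norm_num : (1 / 8 : ℝ) < 1 / 2))
  set ψ := (polyCoord n d).symm with hψ
  set D := {a | ((ψ a : MvPolynomial.restrictTotalDegree (Fin n) ℝ d) : MvPolynomial (Fin n) ℝ) ∈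
    convexPolys l u d} with hD
  set loss : _ → ℝ := fun a => lsLoss x y m
    ((ψ a : MvPolynomial.restrictTotalDegree (Fin n) ℝ d) : MvPolynomial (Fin n) ℝ) with hloss
  have hlin : ∀ L : MvPolynomial (Fin n) ℝ →ₗ[ℝ] ℝ, Continuous fun a =>
      L ((ψ a : MvPolynomial.restrictTotalDegree (Fin n) ℝ d) : MvPolynomial (Fin n) ℝ) := fun L =>
    LinearMap.continuous_of_finiteDimensional
      (L.comp ((Submodule.subtype _).comp ψ.toLinearMap))
  have hDc : IsClosed D := by
    have : D = ⋂ z ∈ Set.Icc l u, ⋂ v, {a | 0 ≤ hessianForm z v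
        ((ψ a : MvPolynomial.restrictTotalDegree (Fin n) ℝ d) : MvPolynomial (Fin n) ℝ)} := by
      ext a
      simp only [hD, Set.mem_iInter]
      refine mem_convexPolys_iff.trans ⟨fun h => h.2, fun h => ⟨(ψ a).2, h⟩⟩
    rw [this]
    exact isClosed_biInter fun z _ => isClosed_iInter fun v =>
      isClosed_le continuous_const (hlin _)
  have hlc : Continuous loss := by
    refine continuous_finsetSum _ fun i _ => (continuous_const.sub ?_).pow 2
    have := hlin (MvPolynomial.aeval (R := ℝ) (x i)).toLinearMap
    exact this
  set Q := lsLoss x y m 0 with hQ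
  have hQ0 : ∀ i ∈ Finset.range m, |y i| ≤ Real.sqrt Q := fun i hi => by
    refine Real.abs_le_sqrt ?_
    have : y i ^ 2 ≤ ∑ i ∈ Finset.range m, y i ^ 2 :=
      Finset.single_le_sum (f := fun i => y i ^ 2) (fun _ _ => sq_nonneg _) hi
    simpa [hQ, lsLoss] using this
  have hcomp : IsCompact (D ∩ {a | loss a ≤ Q}) := by
    refine (isCompact_closedBall 0 (A * (9 * (2 * Real.sqrt Q)))).of_isClosed_subset
      (hDc.inter (isClosed_le hlc continuous_const)) fun a ha => ?_
    rw [mem_closedBall_zero_iff]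
    have := hA (ψ a) (9 * (2 * Real.sqrt Q)) fun z hz => by
      refine (convexOn_of_mem_convexPolys ha.1).abs_le_of_anchorBox hlu (by norm_num) le_rfl
        (fun b => ?_) hz
      obtain ⟨i, hi, hib⟩ := hex b
      refine ⟨x i, hib, ?_⟩
      have h1 : |y i - MvPolynomial.eval (x i) (ψ a : MvPolynomial (Fin n) ℝ)| ≤ Real.sqrt Q := by
        refine Real.abs_le_sqrt (le_trans ?_ ha.2)
        exact Finset.single_le_sum
          (f := fun i => (y i - MvPolynomial.eval (x i) (ψ a : MvPolynomial (Fin n) ℝ)) ^ 2)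
          (fun _ _ => sq_nonneg _) hi
      have h1 := abs_le.1 h1
      have h2 := abs_le.1 (hQ0 i hi)
      rw [abs_le]
      constructor <;> linarith [h1.1, h1.2, h2.1, h2.2]
    simpa [hψ] using this
  have h0 : (0 : Fin _ → ℝ) ∈ D ∩ {a | loss a ≤ Q} := by
    constructor
    · change ((ψ 0 : MvPolynomial.restrictTotalDegree (Fin n) ℝ d) : MvPolynomial (Fin n) ℝ) ∈
        convexPolys l u d
      rw [map_zero]
      exact zero_mem_convexPolys l u d
    · change loss 0 ≤ Q
      simp only [hloss, map_zero, hQ]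
      exact le_rfl
  obtain ⟨a, ha, hmin⟩ := hcomp.exists_isMinOn ⟨0, h0⟩ hlc.continuousOn
  refine ⟨ψ a, ha.1, fun h hh => ?_⟩
  rcases le_or_gt (lsLoss x y m h) Q with hl | hl
  · set b := polyCoord n d ⟨h, (mem_convexPolys_iff.1 hh).1⟩ with hb
    have hbh : ((ψ b : MvPolynomial.restrictTotalDegree (Fin n) ℝ d) : MvPolynomial (Fin n) ℝ)
        = h := by simp [hψ, hb]
    have hbm : b ∈ D ∩ {a | loss a ≤ Q} := by
      constructor
      · change ((ψ b : MvPolynomial.restrictTotalDegree (Fin n) ℝ d) : MvPolynomial (Fin n) ℝ) ∈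
        convexPolys l u d
        rwa [hbh]
      · change lsLoss x y m _ ≤ Q
        rwa [hbh]
    have := hmin hbm
    change loss a ≤ loss b at this
    simpa only [hloss, hbh] using this
  · exact le_trans ha.2 hl.le

end RegularSample

/-! ### Optimality inequalities -/

namespace IsConvexRegressor

variable {n : ℕ} {l u : Fin n → ℝ} {x : ℕ → Fin n → ℝ} {y : ℕ → ℝ} {m d : ℕ}
  {g h : MvPolynomial (Fin n) ℝ}

/-- First-order optimality on the segment from `g` to `h`: moving by `τ` changes the loss by `2τ(T -
S) + τ² S`, which must be nonnegative for small `τ`. -/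
theorem sum_sq_sub_le (hg : IsConvexRegressor l u x y m d g) (hh : h ∈ convexPolys l u d) :
    ∑ i ∈ Finset.range m, (MvPolynomial.eval (x i) g - MvPolynomial.eval (x i) h) ^ 2 ≤
      ∑ i ∈ Finset.range m, (y i - MvPolynomial.eval (x i) h) *
        (MvPolynomial.eval (x i) g - MvPolynomial.eval (x i) h) := by
  set S := ∑ i ∈ Finset.range m, (MvPolynomial.eval (x i) g - MvPolynomial.eval (x i) h) ^ 2
    with hS
  set T := ∑ i ∈ Finset.range m, (y i - MvPolynomial.eval (x i) h) *
        (MvPolynomial.eval (x i) g - MvPolynomial.eval (x i) h) with hT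
  have key : ∀ τ : ℝ, 0 < τ → τ ≤ 1 → 2 * (S - T) ≤ τ * S := fun τ h0 h1 => by
    have hm := convex_convexPolys l u d hg.1 hh (sub_nonneg.2 h1) h0.le (by ring)
    have h2 := hg.2 _ hm
    have h3 : lsLoss x y m ((1 - τ) • g + τ • h) =
        lsLoss x y m g + 2 * τ * (T - S) + τ ^ 2 * S := by
      simp only [lsLoss, hS, hT, Finset.mul_sum, ← Finset.sum_add_distrib,
        ← Finset.sum_sub_distrib]
      refine Finset.sum_congr rfl fun i _ => ?_
      simp only [map_add, MvPolynomial.smul_eval]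
      ring
    rw [h3] at h2
    nlinarith
  have hS0 : 0 ≤ S := Finset.sum_nonneg fun _ _ => sq_nonneg _
  by_contra! hlt
  -- This `τ` satisfies `τ S ≤ S - T`, against `2(S - T) ≤ τ S`; the `+ 1` avoids division by zero.
  have h1 := key (min 1 ((S - T) / (S + 1))) (lt_min one_pos (div_pos (by linarith) (by linarith)))
    (min_le_left _ _)
  have h2 : min 1 ((S - T) / (S + 1)) * S ≤ (S - T) / (S + 1) * S :=
    mul_le_mul_of_nonneg_right (min_le_right _ _) hS0
  have h3 : (S - T) / (S + 1) * S ≤ S - T := by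
    rw [div_mul_eq_mul_div, div_le_iff₀ (by linarith)]
    nlinarith
  linarith

theorem sum_sq_eval_le (hg : IsConvexRegressor l u x y m d g) :
    ∑ i ∈ Finset.range m, MvPolynomial.eval (x i) g ^ 2 ≤ 4 * ∑ i ∈ Finset.range m, y i ^ 2 := by
  have h1 := hg.2 0 (zero_mem_convexPolys l u d)
  have h2 : ∑ i ∈ Finset.range m, MvPolynomial.eval (x i) g ^ 2 ≤
      2 * lsLoss x y m g + 2 * lsLoss x y m 0 := by
    simp only [lsLoss, Finset.mul_sum, ← Finset.sum_add_distrib]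
    refine Finset.sum_le_sum fun i _ => ?_
    simp only [map_zero, sub_zero]
    nlinarith [sq_nonneg (MvPolynomial.eval (x i) g - 2 * y i)]
  have h3 : lsLoss x y m 0 = ∑ i ∈ Finset.range m, y i ^ 2 := by simp [lsLoss]
  linarith

/-- Write `y - h = ν + (f - h)`; Young's inequality absorbs half of `∑ (g - h)²` from the second
part. -/
theorem sum_sq_sub_regression_le {f : (Fin n → ℝ) → ℝ} {ν : ℕ → ℝ} {δ η : ℝ}
    (hg : IsConvexRegressor l u x y m d g) (hh : h ∈ convexPolys l u d)
    (hy : ∀ i, y i = f (x i) + ν i)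
    (hδ : ∀ i, |MvPolynomial.eval (x i) h - f (x i)| ≤ δ)
    (hη : ∑ i ∈ Finset.range m, ν i * (MvPolynomial.eval (x i) g - MvPolynomial.eval (x i) h) ≤
      η * m) :
    ∑ i ∈ Finset.range m, (MvPolynomial.eval (x i) g - f (x i)) ^ 2 ≤
      (4 * η + 4 * δ ^ 2) * m := by
  have hd : ∀ i, (MvPolynomial.eval (x i) h - f (x i)) ^ 2 ≤ δ ^ 2 := fun i =>
    sq_le_sq' (abs_le.1 (hδ i)).1 (abs_le.1 (hδ i)).2
  have hsum : ∑ _i ∈ Finset.range m, δ ^ 2 = δ ^ 2 * m := by simp [mul_comm]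
  have h1 := hg.sum_sq_sub_le hh
  have h2 : ∑ i ∈ Finset.range m, (y i - MvPolynomial.eval (x i) h) *
        (MvPolynomial.eval (x i) g - MvPolynomial.eval (x i) h) ≤
      ∑ i ∈ Finset.range m, ν i * (MvPolynomial.eval (x i) g - MvPolynomial.eval (x i) h) +
      (δ ^ 2 * m + ∑ i ∈ Finset.range m,
        (MvPolynomial.eval (x i) g - MvPolynomial.eval (x i) h) ^ 2) / 2 := by
    rw [← hsum,
      ← Finset.sum_add_distrib, Finset.sum_div, ← Finset.sum_add_distrib]
    refine Finset.sum_le_sum fun i _ => ?_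
    rw [hy]
    nlinarith [hd i, sq_nonneg ((f (x i) - MvPolynomial.eval (x i) h) -
      (MvPolynomial.eval (x i) g - MvPolynomial.eval (x i) h))]
  have h3 : ∑ i ∈ Finset.range m, (MvPolynomial.eval (x i) g - f (x i)) ^ 2 ≤
      2 * ∑ i ∈ Finset.range m, (MvPolynomial.eval (x i) g - MvPolynomial.eval (x i) h) ^ 2 +
        2 * (δ ^ 2 * m) := by
    rw [← hsum,
      Finset.mul_sum, Finset.mul_sum, ← Finset.sum_add_distrib]
    refine Finset.sum_le_sum fun i _ => ?_
    nlinarith [hd i, sq_nonneg ((MvPolynomial.eval (x i) g - MvPolynomial.eval (x i) h) -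
      (MvPolynomial.eval (x i) h - f (x i)))]
  linarith

end IsConvexRegressor

/-! ### Deterministic consistency on a regular sample -/

namespace RegularSample

variable {n : ℕ} {l u : Fin n → ℝ} {f : (Fin n → ℝ) → ℝ} {x : ℕ → Fin n → ℝ} {y ν : ℕ → ℝ}

theorem exists_sum_sq_noise_le (hs : RegularSample l u f x y ν) :
    ∃ V, 0 ≤ V ∧ ∀ᶠ m : ℕ in Filter.atTop, ∑ i ∈ Finset.range m, ν i ^ 2 ≤ V * m := by
  obtain ⟨V, hV⟩ := hs.sq
  refine ⟨|V| + 1, by positivity, eventually_le_mul_of_tendsto_div hV ?_⟩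
  linarith [le_abs_self V]

theorem exists_regressor_sum_sq_le (hs : RegularSample l u f x y ν)
    (hf : ContinuousOn f (Set.Icc l u)) :
    ∃ M, 0 ≤ M ∧ ∀ᶠ m : ℕ in Filter.atTop, ∀ d g, IsConvexRegressor l u x y m d g →
      ∑ i ∈ Finset.range m, MvPolynomial.eval (x i) g ^ 2 ≤ M * m := by
  obtain ⟨F, hF⟩ := isCompact_Icc.exists_bound_of_continuousOn hf
  obtain ⟨V, hV0, hV⟩ := hs.exists_sum_sq_noise_le
  refine ⟨8 * (F ^ 2 + V), by positivity, ?_⟩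
  filter_upwards [hV] with m hm d g hg
  refine hg.sum_sq_eval_le.trans ?_
  have h1 : ∑ i ∈ Finset.range m, y i ^ 2 ≤
      ∑ i ∈ Finset.range m, (2 * F ^ 2 + 2 * ν i ^ 2) := by
    refine Finset.sum_le_sum fun i _ => ?_
    have h2 := abs_le.1 (hF _ (hs.mem i))
    have h3 := sq_le_sq' h2.1 h2.2
    rw [hs.eq]
    nlinarith [sq_nonneg (f (x i) - ν i)]
  simp only [Finset.sum_add_distrib, ← Finset.mul_sum, Finset.sum_const, Finset.card_range,
    nsmul_eq_mul] at h1
  linarith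

/-- If `|g - f| > ε` at a point of `C`, the common Lipschitz bound keeps it at least `ε / 2` on a
whole ball of a fixed finite cover, and that ball holds a fixed fraction `p` of the samples. -/
theorem exists_uniform_close (hs : RegularSample l u f x y ν) (hlu : ∀ k, l k < u k) {K : NNReal}
    (hf : LipschitzOnWith K f (Set.Icc l u)) {C : Set (Fin n → ℝ)} (hC : IsCompact C)
    (hCB : C ⊆ interior (Set.Icc l u)) {M : ℝ} (hM : 0 ≤ M) {ε : ℝ} (hε : 0 < ε) :
    ∃ δ > 0, ∀ᶠ m : ℕ in Filter.atTop, ∀ g : (Fin n → ℝ) → ℝ, ConvexOn ℝ (Set.Icc l u) g →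
      ∑ i ∈ Finset.range m, g (x i) ^ 2 ≤ M * m →
      ∑ i ∈ Finset.range m, (g (x i) - f (x i)) ^ 2 ≤ δ * m → ∀ z ∈ C, |g z - f z| ≤ ε := by
  obtain ⟨t', ht'0, ht'⟩ := hC.exists_subset_innerBox hlu hCB
  set t := min t' (1 / 8) with ht
  have ht0 : 0 < t := lt_min ht'0 (by norm_num)
  have hCt : C ⊆ innerBox l u t := ht'.trans (innerBox_subset hlu (min_le_left _ _))
  have ht8 : t ≤ 1 / 8 := min_le_right _ _
  obtain ⟨A, hA0, hA⟩ := hs.exists_abs_le_on_innerBox hlu (half_pos ht0) (by linarith) hM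
  obtain ⟨r, hr0, hr⟩ := exists_closedBall_subset_innerBox hlu (half_lt_self ht0)
  set L := 2 * A / (r / 2) + K with hL
  have hL0 : 0 ≤ L := by positivity
  set ρ := min (r / 8) (ε / (4 * (L + 1))) with hρ
  have hρ0 : 0 < ρ := lt_min (by positivity) (by positivity)
  have hρr : 2 * ρ < r / 2 := by linarith [min_le_left (r / 8) (ε / (4 * (L + 1)))]
  have hρL : L * (2 * ρ) ≤ ε / 2 := by
    have h1 : ρ ≤ ε / (4 * (L + 1)) := min_le_right _ _
    rw [le_div_iff₀ (by positivity)] at h1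
    linarith
  obtain ⟨T, hTC, hTf, hT⟩ := hC.finite_cover_balls hρ0
  have : Finite T := hTf
  obtain ⟨p, hp0, hp⟩ := hs.exists_freq_of_finite (O := fun z : T => Metric.ball (z : Fin n → ℝ) ρ)
    (fun _ => Metric.isOpen_ball) fun z => ⟨z, Metric.mem_ball_self hρ0, hCB (hTC z.2)⟩
  refine ⟨(ε / 2) ^ 2 * p / 2, by positivity, ?_⟩
  filter_upwards [hA, hp, Filter.eventually_gt_atTop 0] with m hAm hpm hm0 g hg hgM hgδ z hz
  have hm0 : (0 : ℝ) < m := by exact_mod_cast hm0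
  by_contra! hlt
  obtain ⟨c, hcT, hzc⟩ := Set.mem_iUnion₂.1 (hT hz)
  have hball : Metric.ball z (2 * (r / 2)) ⊆ innerBox l u (t / 2) := by
    rw [show 2 * (r / 2) = r by ring]
    exact Metric.ball_subset_closedBall.trans (hr z (hCt hz))
  have hbox := innerBox_subset_box hlu (half_pos ht0).le
  have h1 := mul_le_sum_of_freq (c := (ε / 2) ^ 2) (by positivity) (hpm ⟨c, hcT⟩)
    (φ := fun w => (g w - f w) ^ 2) (fun _ => sq_nonneg _) fun i _ hi => by
      have hd : ‖x i - z‖ < 2 * ρ := by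
        rw [← dist_eq_norm]
        have := dist_triangle_right (x i) z c
        have h2 : dist (x i) c < ρ := hi
        have h3 : dist z c < ρ := hzc
        linarith
      have hgl := ConvexOn.abs_sub_le_of_abs_le (half_pos hr0)
        (hg.subset (hball.trans hbox) (convex_ball _ _))
        (fun w hw => hAm g hg hgM w (hball hw)) (hd.trans hρr)
      have hfl := hf.dist_le_mul (x i) (hs.mem i) z (hbox (hball (Metric.mem_ball_self (by
        positivity))))
      rw [Real.dist_eq, dist_eq_norm] at hfl
      have hLd : L * ‖x i - z‖ ≤ ε / 2 :=
        (mul_le_mul_of_nonneg_left hd.le hL0).trans hρL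
      have h4 : |g z - f z| ≤ |g (x i) - f (x i)| + |g (x i) - g z| + |f (x i) - f z| := by
        rw [show g z - f z = (g (x i) - f (x i)) - (g (x i) - g z) + (f (x i) - f z) by ring]
        exact (abs_add_le _ _).trans (add_le_add_left (abs_sub _ _) _)
      rw [← sq_abs (g (x i) - f (x i))]
      refine pow_le_pow_left₀ (by positivity) ?_ 2
      rw [hL, add_mul] at hLd
      linarith
  have h2 : (ε / 2) ^ 2 * p / 2 * m < (ε / 2) ^ 2 * (p * m) := by
    have : 0 < (ε / 2) ^ 2 * p * m := by positivity
    linarith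
  linarith

/-- Expand `g - h` in a basis: the coordinates are bounded uniformly in `g`, so finitely many noise
averages control all `g` at once. -/
theorem eventually_noise_le_of_degree_le (hs : RegularSample l u f x y ν) (hlu : ∀ k, l k < u k)
    {d : ℕ} {h : MvPolynomial (Fin n) ℝ} (hh : h ∈ convexPolys l u d) {M : ℝ} (hM : 0 ≤ M)
    {η : ℝ} (hη : 0 < η) :
    ∀ᶠ m : ℕ in Filter.atTop, ∀ g ∈ convexPolys l u d,
      ∑ i ∈ Finset.range m, MvPolynomial.eval (x i) g ^ 2 ≤ M * m →
      ∑ i ∈ Finset.range m, ν i * (MvPolynomial.eval (x i) g - MvPolynomial.eval (x i) h) ≤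
        η * m := by
  obtain ⟨A, hA0, hA⟩ := hs.exists_abs_le_on_innerBox hlu (t := 1 / 8) (by norm_num) le_rfl hM
  obtain ⟨H, hH⟩ := (isCompact_Icc (a := l) (b := u)).exists_bound_of_continuousOn
    (MvPolynomial.continuous_eval h).continuousOn
  obtain ⟨A', hA'0, hA'⟩ := exists_polyCoord_bound d
    (interior_innerBox_nonempty hlu (by norm_num : (1 / 8 : ℝ) < 1 / 2))
  set R := A' * (A + H) with hR
  set b := Module.finBasis ℝ (MvPolynomial.restrictTotalDegree (Fin n) ℝ d) with hb
  have hlim : Filter.Tendsto (fun m : ℕ => (∑ j, R * |∑ i ∈ Finset.range m,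
      ν i * MvPolynomial.eval (x i) (b j : MvPolynomial (Fin n) ℝ)|) / m)
      Filter.atTop (nhds 0) := by
    have := tendsto_finsetSum (Finset.univ) fun j (_ : j ∈ Finset.univ) =>
      ((hs.poly (b j : MvPolynomial (Fin n) ℝ)).abs.const_mul R)
    simp only [abs_zero, mul_zero, Finset.sum_const_zero] at this
    refine this.congr fun m => ?_
    rw [Finset.sum_div]
    refine Finset.sum_congr rfl fun j _ => ?_
    rw [abs_div, Nat.abs_cast, mul_div_assoc]
  filter_upwards [hA, eventually_le_mul_of_tendsto_div hlim hη] with m hAm hm g hg hgM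
  refine le_trans ?_ hm
  set q : MvPolynomial.restrictTotalDegree (Fin n) ℝ d :=
    ⟨g - h, sub_mem (mem_convexPolys_iff.1 hg).1 (mem_convexPolys_iff.1 hh).1⟩ with hq
  have hqn : ‖polyCoord n d q‖ ≤ R := hA' q (A + H) fun z hz => by
    have h1 := hAm _ (convexOn_of_mem_convexPolys hg) hgM z hz
    have h2 := hH z (innerBox_subset_box hlu (by norm_num) hz)
    simp only [hq, map_sub]
    exact (abs_sub _ _).trans (add_le_add h1 h2)
  have hexp : ∀ z, MvPolynomial.eval z g - MvPolynomial.eval z h =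
      ∑ j, polyCoord n d q j * MvPolynomial.eval z (b j : MvPolynomial (Fin n) ℝ) := fun z => by
    have h1 : (q : MvPolynomial (Fin n) ℝ) =
        ∑ j, polyCoord n d q j • (b j : MvPolynomial (Fin n) ℝ) := by
      have := congrArg (Submodule.subtype _) (b.sum_equivFun q).symm
      rw [map_sum] at this
      exact this
    have h2 := congrArg (MvPolynomial.eval z) h1
    simpa only [hq, map_sub, map_sum, MvPolynomial.smul_eval] using h2
  simp only [hexp, Finset.mul_sum]
  rw [Finset.sum_comm]
  refine Finset.sum_le_sum fun j _ => ?_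
  calc ∑ i ∈ Finset.range m, ν i * (polyCoord n d q j *
        MvPolynomial.eval (x i) (b j : MvPolynomial (Fin n) ℝ))
      = polyCoord n d q j * ∑ i ∈ Finset.range m, ν i *
        MvPolynomial.eval (x i) (b j : MvPolynomial (Fin n) ℝ) := by
        rw [Finset.mul_sum]
        exact Finset.sum_congr rfl fun i _ => by ring
    _ ≤ |polyCoord n d q j| * |∑ i ∈ Finset.range m, ν i *
        MvPolynomial.eval (x i) (b j : MvPolynomial (Fin n) ℝ)| := by
        rw [← abs_mul]
        exact le_abs_self _
    _ ≤ _ := mul_le_mul_of_nonneg_right ((norm_le_pi_norm _ j).trans hqn) (abs_nonneg _)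

theorem finite_cells (l u : Fin n → ℝ) (N : ℕ) {K : Set (Fin n → ℝ)} (hK : K ⊆ Set.Icc l u) :
    ((fun (w : Fin n → ℝ) k => ⌊N * w k⌋) '' K).Finite := by
  refine (Set.finite_Icc (fun k => ⌊N * l k⌋) fun k => ⌊N * u k⌋).subset ?_
  rintro _ ⟨w, hw, rfl⟩
  exact ⟨fun k => Int.floor_le_floor (mul_le_mul_of_nonneg_left ((hK hw).1 k) N.cast_nonneg),
    fun k => Int.floor_le_floor (mul_le_mul_of_nonneg_left ((hK hw).2 k) N.cast_nonneg)⟩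

theorem norm_sub_le_of_floor_eq {N : ℕ} (hN : 0 < N) {v w : Fin n → ℝ}
    (h : (fun k => ⌊N * v k⌋) = fun k => ⌊N * w k⌋) : ‖v - w‖ ≤ 1 / N := by
  have hN : (0 : ℝ) < N := by exact_mod_cast hN
  refine (pi_norm_le_iff_of_nonneg (by positivity)).2 fun k => ?_
  have := Int.abs_sub_lt_one_of_floor_eq_floor (congrFun h k)
  rw [← mul_sub, abs_mul, abs_of_pos hN] at this
  rw [Pi.sub_apply, Real.norm_eq_abs, le_div_iff₀ hN]
  linarith

/-- The bound is uniform over all convex `g`, so no degree appears. Four errors of size `η / 4`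
arise: noise averages over cells, oscillation within cells, noise energy in the boundary layer, and
the mean square of `g - h` in Young's inequality. -/
theorem eventually_noise_le_of_layer (hs : RegularSample l u f x y ν) (hlu : ∀ k, l k < u k)
    (hlayer : ∀ η > 0, ∃ t > 0, ∀ᶠ m : ℕ in Filter.atTop,
      ∑ i ∈ Finset.range m, (innerBox l u t)ᶜ.indicator (fun _ => ν i ^ 2) (x i) ≤ η * m)
    {h : (Fin n → ℝ) → ℝ} (hh : ConvexOn ℝ (Set.Icc l u) h)
    (hhc : ContinuousOn h (Set.Icc l u)) {M : ℝ} (hM : 0 ≤ M) {η : ℝ} (hη : 0 < η) :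
    ∀ᶠ m : ℕ in Filter.atTop, ∀ g : (Fin n → ℝ) → ℝ, ConvexOn ℝ (Set.Icc l u) g →
      ∑ i ∈ Finset.range m, g (x i) ^ 2 ≤ M * m →
      ∑ i ∈ Finset.range m, ν i * (g (x i) - h (x i)) ≤ η * m := by
  classical
  obtain ⟨H, hH⟩ := (isCompact_Icc (a := l) (b := u)).exists_bound_of_continuousOn hhc
  have hH0 : 0 ≤ H := (norm_nonneg _).trans (hH _ (hs.mem 0))
  obtain ⟨V, hV0, hV⟩ := hs.exists_sum_sq_noise_le
  -- Young weight for the layer: `κ` makes the `(g - h)²` part at most `η / 4`, and the layer is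
  -- then taken thin enough for the part carrying `1 / (2κ)`.
  set κ := η / (4 * (M + H ^ 2 + 1)) with hκ
  have hκ0 : 0 < κ := by positivity
  obtain ⟨t', ht'0, ht'⟩ := hlayer (κ * η / 2) (by positivity)
  set t := min t' (1 / 8) with ht
  have ht0 : 0 < t := lt_min ht'0 (by norm_num)
  have ht8 : t ≤ 1 / 8 := min_le_right _ _
  have htt : innerBox l u t' ⊆ innerBox l u t := innerBox_subset hlu (min_le_left _ _)
  -- The larger inner box, for `t / 2`, leaves room for cells that straddle the boundary of the one
  -- for `t`.
  obtain ⟨A, hA0, hA⟩ := hs.exists_abs_le_on_innerBox hlu (half_pos ht0) (by linarith) hM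
  obtain ⟨r, hr0, hr⟩ := exists_closedBall_subset_innerBox hlu (half_lt_self ht0)
  set L := 2 * A / (r / 2) + 2 * H / (r / 2) with hL
  have hL0 : 0 ≤ L := by positivity
  obtain ⟨N, hN⟩ := exists_nat_gt (max (2 / r) (4 * L * (V + 1) / η))
  have hN1 : 2 / r < N := (le_max_left _ _).trans_lt hN
  have hN2 : 4 * L * (V + 1) / η < N := (le_max_right _ _).trans_lt hN
  have hN0 : (0 : ℝ) < N := lt_trans (by positivity) hN1
  have hN0' : 0 < N := by exact_mod_cast hN0
  have hNr : 1 / (N : ℝ) < r / 2 := by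
    rw [div_lt_iff₀ hr0] at hN1
    rw [div_lt_iff₀ hN0]
    linarith
  have hNL : L * (1 / N) * (1 + V) ≤ η / 4 := by
    rw [div_lt_iff₀ hη] at hN2
    rw [mul_one_div, div_mul_eq_mul_div, div_le_iff₀ hN0]
    linarith
  set cell : (Fin n → ℝ) → Fin n → ℤ := fun w k => ⌊N * w k⌋ with hcell
  set Z := (finite_cells l u N (innerBox_subset_box hlu ht0.le)).toFinset with hZ
  -- A representative point for each cell meeting the inner box; the value 0 for other cells is
  -- never used.
  have hZr : ∀ z : Fin n → ℤ, ∃ w, z ∈ Z → w ∈ innerBox l u t ∧ cell w = z := fun z => by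
    by_cases hz : z ∈ Z
    · obtain ⟨w, hw⟩ := (Set.Finite.mem_toFinset _).1 hz
      exact ⟨w, fun _ => hw⟩
    · exact ⟨0, fun h => absurd h hz⟩
  choose q hq using hZr
  have hlim : Filter.Tendsto (fun m : ℕ => (∑ z ∈ Z, (A + H) * |∑ i ∈ Finset.range m,
      if cell (x i) = z then ν i else 0|) / m) Filter.atTop (nhds 0) := by
    have := tendsto_finsetSum Z fun z (_ : z ∈ Z) => ((hs.cell N z).abs.const_mul (A + H))
    simp only [abs_zero, mul_zero, Finset.sum_const_zero] at this
    refine this.congr fun m => ?_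
    rw [Finset.sum_div]
    refine Finset.sum_congr rfl fun z _ => ?_
    rw [abs_div, Nat.abs_cast, mul_div_assoc]
  filter_upwards [hA, hV, ht', eventually_le_mul_of_tendsto_div hlim
    (by positivity : 0 < η / 4)] with m hAm hVm htm hlm g hg hgM
  have hbox := innerBox_subset_box hlu (half_pos ht0).le
  have hball : ∀ w ∈ innerBox l u t, Metric.ball w (2 * (r / 2)) ⊆ innerBox l u (t / 2) :=
    fun w hw => by
      rw [show 2 * (r / 2) = r by ring]
      exact Metric.ball_subset_closedBall.trans (hr w hw)
  set φ : (Fin n → ℝ) → ℝ := fun w => g w - h w with hφ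
  have hφA : ∀ w ∈ innerBox l u t, |φ w| ≤ A + H := fun w hw =>
    (abs_sub _ _).trans (add_le_add (hAm g hg hgM w (innerBox_subset hlu (by linarith) hw))
      (hH w (innerBox_subset_box hlu ht0.le hw)))
  have hφL : ∀ v, ∀ w ∈ innerBox l u t, cell v = cell w → |φ v - φ w| ≤ L * (1 / N) :=
    fun v w hw hvw => by
      have hd := norm_sub_le_of_floor_eq hN0' hvw
      have h1 := ConvexOn.abs_sub_le_of_abs_le (half_pos hr0)
        (hg.subset ((hball w hw).trans hbox) (convex_ball _ _))
        (fun v hv => hAm g hg hgM v (hball w hw hv)) (hd.trans_lt hNr)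
      have h2 := ConvexOn.abs_sub_le_of_abs_le (half_pos hr0)
        (hh.subset ((hball w hw).trans hbox) (convex_ball _ _))
        (fun v hv => hH v (hbox (hball w hw hv))) (hd.trans_lt hNr)
      have h3 := mul_le_mul_of_nonneg_left hd hL0
      rw [show φ v - φ w = (g v - g w) - (h v - h w) by simp only [hφ]; ring]
      refine (abs_sub _ _).trans ?_
      have h4 : L * ‖v - w‖ = 2 * A / (r / 2) * ‖v - w‖ + 2 * H / (r / 2) * ‖v - w‖ := by
        rw [hL, add_mul]
      linarith
  have hterm : ∀ i ∈ Finset.range m, ν i * φ (x i) ≤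
      (∑ z ∈ Z, φ (q z) * if cell (x i) = z then ν i else 0) + L * (1 / N) * (1 + ν i ^ 2) +
      (1 / (2 * κ)) * (innerBox l u t')ᶜ.indicator (fun _ => ν i ^ 2) (x i) +
      κ / 2 * φ (x i) ^ 2 := fun i _ => by
    have hφ2 : 0 ≤ κ / 2 * φ (x i) ^ 2 := by positivity
    have hν2 : 0 ≤ L * (1 / N) * (1 + ν i ^ 2) := by positivity
    by_cases hz : cell (x i) ∈ Z
    · have h1 : (∑ z ∈ Z, φ (q z) * if cell (x i) = z then ν i else 0) =
          φ (q (cell (x i))) * ν i := by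
        rw [Finset.sum_eq_single_of_mem _ hz fun z _ hne => by rw [if_neg (Ne.symm hne), mul_zero],
          if_pos rfl]
      have h2 := hq _ hz
      have h3 := hφL (x i) _ h2.1 h2.2.symm
      have h4 : 0 ≤ (1 / (2 * κ)) * (innerBox l u t')ᶜ.indicator (fun _ => ν i ^ 2) (x i) :=
        mul_nonneg (by positivity) (Set.indicator_nonneg (fun _ _ => sq_nonneg _) _)
      have h5 : ν i * (φ (x i) - φ (q (cell (x i)))) ≤ L * (1 / N) * (1 + ν i ^ 2) := by
        refine (le_abs_self _).trans ?_
        rw [abs_mul, mul_comm]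
        refine mul_le_mul h3 ?_ (abs_nonneg _) (by positivity)
        nlinarith [sq_abs (ν i), sq_nonneg (|ν i| - 1)]
      rw [h1]
      linarith
    · have h1 : (∑ z ∈ Z, φ (q z) * if cell (x i) = z then ν i else 0) = 0 :=
        Finset.sum_eq_zero fun z hzZ => by
          rw [if_neg (fun hc => hz (by rwa [hc])), mul_zero]
      have h2 : x i ∉ innerBox l u t' := fun hx =>
        hz ((Set.Finite.mem_toFinset _).2 ⟨x i, htt hx, rfl⟩)
      rw [h1, Set.indicator_of_mem h2]
      have h3 : ν i * φ (x i) ≤ 1 / (2 * κ) * ν i ^ 2 + κ / 2 * φ (x i) ^ 2 := by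
        have h4 : 1 / (2 * κ) * ν i ^ 2 + κ / 2 * φ (x i) ^ 2 - ν i * φ (x i) =
            1 / (2 * κ) * (ν i - κ * φ (x i)) ^ 2 := by
          field_simp
          ring
        have h5 : 0 ≤ 1 / (2 * κ) * (ν i - κ * φ (x i)) ^ 2 := by positivity
        linarith
      linarith
  refine (Finset.sum_le_sum hterm).trans ?_
  simp only [Finset.sum_add_distrib, ← Finset.mul_sum]
  have b1 : ∑ i ∈ Finset.range m, ∑ z ∈ Z, φ (q z) * (if cell (x i) = z then ν i else 0) ≤
      η / 4 * m := by
    refine le_trans ?_ hlm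
    rw [Finset.sum_comm]
    refine Finset.sum_le_sum fun z hz => ?_
    rw [← Finset.mul_sum]
    refine (le_abs_self _).trans ?_
    rw [abs_mul]
    exact mul_le_mul_of_nonneg_right (hφA _ (hq z hz).1) (abs_nonneg _)
  have b2 : L * (1 / N) * (∑ i ∈ Finset.range m, (1 : ℝ) + ∑ i ∈ Finset.range m, ν i ^ 2) ≤
      η / 4 * m := by
    have : ∑ i ∈ Finset.range m, (1 : ℝ) + ∑ i ∈ Finset.range m, ν i ^ 2 ≤ (1 + V) * m := by
      simp only [Finset.sum_const, Finset.card_range, nsmul_eq_mul]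
      linarith
    refine (mul_le_mul_of_nonneg_left this (by positivity)).trans ?_
    rw [← mul_assoc]
    exact mul_le_mul_of_nonneg_right hNL m.cast_nonneg
  have b3 : 1 / (2 * κ) *
      ∑ i ∈ Finset.range m, (innerBox l u t')ᶜ.indicator (fun _ => ν i ^ 2) (x i) ≤ η / 4 * m := by
    refine (mul_le_mul_of_nonneg_left htm (by positivity)).trans (le_of_eq ?_)
    field_simp
    ring
  have b4 : κ / 2 * ∑ i ∈ Finset.range m, φ (x i) ^ 2 ≤ η / 4 * m := by
    have h1 : ∑ i ∈ Finset.range m, φ (x i) ^ 2 ≤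
        ∑ i ∈ Finset.range m, (2 * g (x i) ^ 2 + 2 * H ^ 2) := by
      refine Finset.sum_le_sum fun i _ => ?_
      have h2 := abs_le.1 (hH _ (hs.mem i))
      have h3 := sq_le_sq' h2.1 h2.2
      simp only [hφ]
      nlinarith [sq_nonneg (g (x i) + h (x i))]
    simp only [Finset.sum_add_distrib, ← Finset.mul_sum, Finset.sum_const, Finset.card_range,
    nsmul_eq_mul] at h1
    have h2 : ∑ i ∈ Finset.range m, φ (x i) ^ 2 ≤ 2 * (M + H ^ 2 + 1) * m := by
      have : (0 : ℝ) ≤ m := m.cast_nonneg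
      linarith
    refine (mul_le_mul_of_nonneg_left h2 (by positivity)).trans (le_of_eq ?_)
    rw [hκ]
    field_simp
  linarith

theorem iterated_limit (hs : RegularSample l u f x y ν) (hlu : ∀ k, l k < u k) {K : NNReal}
    (hf : LipschitzOnWith K f (Set.Icc l u)) (hfc : ConvexOn ℝ (Set.Icc l u) f)
    {C : Set (Fin n → ℝ)} (hC : IsCompact C) (hCB : C ⊆ interior (Set.Icc l u)) {ε : ℝ}
    (hε : 0 < ε) :
    ∃ d₀ : ℕ, ∀ d ≥ d₀, ∃ m₀ : ℕ, ∀ m ≥ m₀, ∀ g : MvPolynomial (Fin n) ℝ,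
      IsConvexRegressor l u x y m d g → ∀ z ∈ C, |MvPolynomial.eval z g - f z| ≤ ε := by
  obtain ⟨M, hM0, hM⟩ := hs.exists_regressor_sum_sq_le hf.continuousOn
  obtain ⟨δ, hδ0, hδ⟩ := hs.exists_uniform_close hlu hf hC hCB hM0 hε
  -- With `δ / 8` for both the squared approximation error and the noise level, `4 η + 4 δ²` in
  -- `sum_sq_sub_regression_le` becomes exactly the present `δ`.
  obtain ⟨h, hhess, hhf⟩ := exists_convex_polynomial_near hf hfc
    (Real.sqrt_pos.2 (by positivity : 0 < δ / 8))
  refine ⟨h.totalDegree, fun d hd => ?_⟩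
  have hh : h ∈ convexPolys l u d := ⟨hd, hhess⟩
  refine Filter.eventually_atTop.1 ?_
  filter_upwards [hM, hδ, hs.eventually_noise_le_of_degree_le hlu hh hM0
    (by positivity : 0 < δ / 8)] with m hMm hδm hνm g hg
  refine hδm _ (convexOn_of_mem_convexPolys hg.1) (hMm d g hg) ?_
  refine (hg.sum_sq_sub_regression_le hh hs.eq (fun i => hhf _ (hs.mem i))
    (hνm g hg.1 (hMm d g hg))).trans (le_of_eq ?_)
  rw [Real.sq_sqrt (by positivity)]
  ring

theorem joint_limit (hs : RegularSample l u f x y ν) (hlu : ∀ k, l k < u k) {K : NNReal}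
    (hf : LipschitzOnWith K f (Set.Icc l u)) (hfc : ConvexOn ℝ (Set.Icc l u) f)
    (hlayer : ∀ η > 0, ∃ t > 0, ∀ᶠ m : ℕ in Filter.atTop,
      ∑ i ∈ Finset.range m, (innerBox l u t)ᶜ.indicator (fun _ => ν i ^ 2) (x i) ≤ η * m)
    {C : Set (Fin n → ℝ)} (hC : IsCompact C) (hCB : C ⊆ interior (Set.Icc l u)) {ε : ℝ}
    (hε : 0 < ε) :
    ∃ N : ℕ, ∀ m ≥ N, ∀ d ≥ N, ∀ g : MvPolynomial (Fin n) ℝ,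
      IsConvexRegressor l u x y m d g → ∀ z ∈ C, |MvPolynomial.eval z g - f z| ≤ ε := by
  obtain ⟨M, hM0, hM⟩ := hs.exists_regressor_sum_sq_le hf.continuousOn
  obtain ⟨δ, hδ0, hδ⟩ := hs.exists_uniform_close hlu hf hC hCB hM0 hε
  obtain ⟨h, hhess, hhf⟩ := exists_convex_polynomial_near hf hfc
    (Real.sqrt_pos.2 (by positivity : 0 < δ / 8))
  obtain ⟨m₀, hm₀⟩ := Filter.eventually_atTop.1 (hM.and (hδ.and
    (hs.eventually_noise_le_of_layer hlu hlayer
      (convexOn_eval_of_posSemidef (convex_Icc l u) hhess)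
      (MvPolynomial.continuous_eval h).continuousOn hM0 (by positivity : 0 < δ / 8))))
  refine ⟨max m₀ h.totalDegree, fun m hm d hd g hg => ?_⟩
  obtain ⟨hMm, hδm, hνm⟩ := hm₀ m ((le_max_left _ _).trans hm)
  have hgc := convexOn_of_mem_convexPolys hg.1
  refine hδm _ hgc (hMm d g hg) ?_
  refine (hg.sum_sq_sub_regression_le ⟨(le_max_right _ _).trans hd, hhess⟩ hs.eq
    (fun i => hhf _ (hs.mem i)) (hνm _ hgc (hMm d g hg))).trans (le_of_eq ?_)
  rw [Real.sq_sqrt (by positivity)]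
  ring

end RegularSample

/-! ### Independence of the pairs and the almost sure event -/

section Probability

variable {n : ℕ} {Ω : Type*} {mΩ : MeasurableSpace Ω} {μ : Measure Ω}
  {X : ℕ → Ω → (Fin n → ℝ)} {ν : ℕ → Ω → ℝ}

theorem ProbabilityTheory.indepFun_prodMk_of_rectangles [IsProbabilityMeasure μ]
    {α β γ δ : Type*} [MeasurableSpace α] [MeasurableSpace β] [MeasurableSpace γ] [MeasurableSpace δ]
    {f : Ω → α} {g : Ω → β} {f' : Ω → γ}
    {g' : Ω → δ} (hf : Measurable f) (hg : Measurable g) (hf' : Measurable f') (hg' : Measurable g')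
    (h : ∀ S A S' A', MeasurableSet S → MeasurableSet A → MeasurableSet S' → MeasurableSet A' →
      μ ((f ⁻¹' S ∩ g ⁻¹' A) ∩ (f' ⁻¹' S' ∩ g' ⁻¹' A')) =
        μ (f ⁻¹' S ∩ g ⁻¹' A) * μ (f' ⁻¹' S' ∩ g' ⁻¹' A')) :
    IndepFun (fun ω => (f ω, g ω)) (fun ω => (f' ω, g' ω)) μ := by
  rw [IndepFun_iff_Indep]
  refine IndepSets.indep (hf.prodMk hg).comap_le (hf'.prodMk hg').comap_le
    ((isPiSystem_prod (α := α) (β := β)).comap fun ω => (f ω, g ω))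
    ((isPiSystem_prod (α := γ) (β := δ)).comap fun ω => (f' ω, g' ω)) ?_ ?_ ?_
  · rw [← generateFrom_prod (α := α) (β := β), MeasurableSpace.comap_generateFrom]
    rfl
  · rw [← generateFrom_prod (α := γ) (β := δ), MeasurableSpace.comap_generateFrom]
    rfl
  · rw [IndepSets_iff]
    rintro _ _ ⟨_, ⟨S, hS, A, hA, rfl⟩, rfl⟩ ⟨_, ⟨S', hS', A', hA', rfl⟩, rfl⟩
    exact h S A S' A' hS hA hS' hA'

theorem measureReal_inter_eq_setIntegral_condExp {m : MeasurableSpace Ω} {mΩ : MeasurableSpace Ω}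
    {μ : Measure Ω} [IsFiniteMeasure μ] (hm : m ≤ mΩ) {T E : Set Ω} (hT : MeasurableSet[m] T)
    (hE : MeasurableSet E) : μ.real (T ∩ E) = ∫ ω in T, (μ⟦E | m⟧) ω ∂μ := by
  rw [setIntegral_condExp hm ((integrable_const 1).indicator hE) hT, setIntegral_indicator hE,
    setIntegral_const]
  simp

/-- On rectangles, conditioning on the features turns the joint probability into the integral of a
product of one function of `X i` and one of `X j`, which factors by independence of the features. -/
theorem pairwise_indepFun_of_conditional_indep [IsProbabilityMeasure μ]
    (hXm : ∀ i, Measurable (X i))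
    (hνm : ∀ i, Measurable (ν i)) (hXindep : iIndepFun X μ)
    (hνcond : ∀ (m : ℕ) (A : ℕ → Set ℝ), (∀ i, MeasurableSet (A i)) →
      μ⟦⋂ i ∈ Finset.range m, ν i ⁻¹' A i |
          ⨆ i ∈ Finset.range m, MeasurableSpace.comap (X i) inferInstance⟧
        =ᵐ[μ] fun ω => ∏ i ∈ Finset.range m,
          (μ⟦ν i ⁻¹' A i | MeasurableSpace.comap (X i) inferInstance⟧) ω) {i j : ℕ} (hij : i ≠ j) :
    IndepFun (fun ω => (X i ω, ν i ω)) (fun ω => (X j ω, ν j ω)) μ := by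
  refine indepFun_prodMk_of_rectangles (hXm i) (hνm i) (hXm j) (hνm j)
    fun S A S' A' hS hA hS' hA' => ?_
  set m := max i j + 1 with hm
  have hi : i ∈ Finset.range m := Finset.mem_range.2 (Nat.lt_succ_of_le (le_max_left _ _))
  have hj : j ∈ Finset.range m := Finset.mem_range.2 (Nat.lt_succ_of_le (le_max_right _ _))
  set D : ℕ → Set ℝ := fun k => if k = i then A else if k = j then A' else Set.univ with hD
  have hDm : ∀ k, MeasurableSet (D k) := fun k => by
    simp only [hD]
    split_ifs
    exacts [hA, hA', MeasurableSet.univ]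
  have hDi : D i = A := by simp [hD]
  have hDj : D j = A' := by simp [hD, hij.symm]
  have hDk : ∀ k, k ≠ i → k ≠ j → D k = Set.univ := fun k h1 h2 => by simp [hD, h1, h2]
  set σX : ℕ → MeasurableSpace Ω := fun k => MeasurableSpace.comap (X k) inferInstance with hσX
  have hσle : ∀ k, σX k ≤ mΩ := fun k => (hXm k).comap_le
  have hFle : ⨆ k ∈ Finset.range m, σX k ≤ mΩ := iSup₂_le fun k _ => hσle k
  set a : Ω → ℝ := μ⟦ν i ⁻¹' A | σX i⟧ with ha
  set b : Ω → ℝ := μ⟦ν j ⁻¹' A' | σX j⟧ with hb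
  have hE : (⋂ k ∈ Finset.range m, ν k ⁻¹' D k) = ν i ⁻¹' A ∩ ν j ⁻¹' A' := by
    ext ω
    simp only [Set.mem_iInter, Set.mem_inter_iff, Set.mem_preimage]
    refine ⟨fun h => ⟨hDi ▸ h i hi, hDj ▸ h j hj⟩, fun h k _ => ?_⟩
    by_cases h1 : k = i
    · subst h1
      rw [hDi]
      exact h.1
    · by_cases h2 : k = j
      · subst h2
        rw [hDj]
        exact h.2
      · rw [hDk k h1 h2]
        trivial
  have hprod : ∀ ω, ∏ k ∈ Finset.range m, (μ⟦ν k ⁻¹' D k | σX k⟧) ω = a ω * b ω := fun ω => by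
    rw [Finset.prod_eq_mul_of_mem i j hi hj hij, hDi, hDj]
    intro k _ hk
    rw [hDk k hk.1 hk.2, Set.preimage_univ, Set.indicator_univ, condExp_const (hσle k)]
  have hcond := hνcond m D hDm
  rw [hE] at hcond
  replace hcond := hcond.trans (.of_forall hprod)
  have hreal : ∀ k (S : Set (Fin n → ℝ)) (A : Set ℝ), MeasurableSet S → MeasurableSet A →
      ∫ ω, (X k ⁻¹' S).indicator (μ⟦ν k ⁻¹' A | σX k⟧) ω ∂μ = μ.real (X k ⁻¹' S ∩ ν k ⁻¹' A) :=
    fun k S A hS hA => by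
      rw [integral_indicator (hXm k hS),
        measureReal_inter_eq_setIntegral_condExp (hσle k) ⟨S, hS, rfl⟩ (hνm k hA)]
  have hTm : MeasurableSet[⨆ k ∈ Finset.range m, σX k] (X i ⁻¹' S ∩ X j ⁻¹' S') :=
    MeasurableSet.inter (le_iSup₂ (f := fun k _ => σX k) i hi _ ⟨S, hS, rfl⟩)
      (le_iSup₂ (f := fun k _ => σX k) j hj _ ⟨S', hS', rfl⟩)
  have hEm : MeasurableSet (ν i ⁻¹' A ∩ ν j ⁻¹' A') := (hνm i hA).inter (hνm j hA')
  have hmeas : ∀ k (S : Set (Fin n → ℝ)) (A : Set ℝ), MeasurableSet S →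
      Measurable[σX k] ((X k ⁻¹' S).indicator (μ⟦ν k ⁻¹' A | σX k⟧)) := fun k S A hS =>
    (stronglyMeasurable_condExp.measurable).indicator ⟨S, hS, rfl⟩
  have hind : IndepFun ((X i ⁻¹' S).indicator a) ((X j ⁻¹' S').indicator b) μ := by
    rw [IndepFun_iff_Indep]
    exact indep_of_indep_of_le_left (indep_of_indep_of_le_right
      ((IndepFun_iff_Indep _ _ _).1 (hXindep.indepFun hij)) (hmeas j S' A' hS').comap_le)
      (hmeas i S A hS).comap_le
  have key : μ.real ((X i ⁻¹' S ∩ ν i ⁻¹' A) ∩ (X j ⁻¹' S' ∩ ν j ⁻¹' A')) =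
      μ.real (X i ⁻¹' S ∩ ν i ⁻¹' A) * μ.real (X j ⁻¹' S' ∩ ν j ⁻¹' A') := by
    have h1 : μ.real ((X i ⁻¹' S ∩ X j ⁻¹' S') ∩ (ν i ⁻¹' A ∩ ν j ⁻¹' A')) =
        ∫ ω in X i ⁻¹' S ∩ X j ⁻¹' S', a ω * b ω ∂μ := by
      rw [measureReal_inter_eq_setIntegral_condExp hFle hTm hEm]
      exact setIntegral_congr_ae (hFle _ hTm) (hcond.mono fun ω hω _ => hω)
    rw [Set.inter_inter_inter_comm, h1, ← integral_indicator (hFle _ hTm), ← hreal i S A hS hA,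
      ← hreal j S' A' hS' hA', ← hind.integral_fun_mul_eq_mul_integral
        ((hmeas i S A hS).mono (hσle i) le_rfl).aestronglyMeasurable
        ((hmeas j S' A' hS').mono (hσle j) le_rfl).aestronglyMeasurable]
    refine integral_congr_ae (.of_forall fun ω => ?_)
    exact Set.inter_indicator_mul _ _ _
  rw [measureReal_def, measureReal_def, measureReal_def, ← ENNReal.toReal_mul] at key
  exact (ENNReal.toReal_eq_toReal_iff' (measure_ne_top _ _)
    (ENNReal.mul_ne_top (measure_ne_top _ _) (measure_ne_top _ _))).1 key

theorem ae_tendsto_average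
    (hind : Pairwise fun i j => IndepFun (fun ω => (X i ω, ν i ω)) (fun ω => (X j ω, ν j ω)) μ)
    (hident : ∀ i, IdentDistrib (fun ω => (X i ω, ν i ω)) (fun ω => (X 0 ω, ν 0 ω)) μ μ)
    {Φ : (Fin n → ℝ) × ℝ → ℝ} (hΦ : Measurable Φ)
    (hint : Integrable (fun ω => Φ (X 0 ω, ν 0 ω)) μ) :
    ∀ᵐ ω ∂μ, Filter.Tendsto (fun m : ℕ => (∑ i ∈ Finset.range m, Φ (X i ω, ν i ω)) / m)
      Filter.atTop (nhds (∫ ω, Φ (X 0 ω, ν 0 ω) ∂μ)) :=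
  strong_law_ae_real (fun i ω => Φ (X i ω, ν i ω)) hint
    (fun _ _ hij => (hind hij).comp hΦ hΦ) fun i => (hident i).comp hΦ

theorem integral_mul_eq_zero_of_condExp_eq_zero [IsProbabilityMeasure μ]
    {Z : Ω → Fin n → ℝ} {ξ : Ω → ℝ}
    (hZ : Measurable Z) (hξ : μ[ξ | MeasurableSpace.comap Z inferInstance] =ᵐ[μ] 0)
    (hint : Integrable ξ μ) {ψ : (Fin n → ℝ) → ℝ} (hψ : Measurable ψ)
    (hprod : Integrable (fun ω => ξ ω * ψ (Z ω)) μ) : ∫ ω, ξ ω * ψ (Z ω) ∂μ = 0 := by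
  have hle : MeasurableSpace.comap Z inferInstance ≤ mΩ := hZ.comap_le
  have hm : StronglyMeasurable[MeasurableSpace.comap Z inferInstance] fun ω => ψ (Z ω) :=
    (hψ.comp (comap_measurable Z)).stronglyMeasurable
  rw [← integral_condExp hle]
  have h := condExp_mul_of_stronglyMeasurable_right hm hprod hint
  rw [integral_congr_ae (g := fun _ => (0 : ℝ)), integral_zero]
  filter_upwards [h, hξ] with ω h1 h2
  change _ = _ at h1
  rw [show (fun ω => ξ ω * ψ (Z ω)) = ξ * fun ω => ψ (Z ω) from rfl, h1, Pi.mul_apply, h2]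
  simp

end Probability

/-- One null set must serve all open sets and all polynomials, so the strong law is applied only to
a countable basis, to monomials and to integer cells. The noise limits vanish because `ν 0` is
conditionally centred given `X 0`. -/
theorem ae_regularSample {n : ℕ} {Ω : Type*} [MeasurableSpace Ω] {μ : Measure Ω}
    [IsProbabilityMeasure μ] {l u : Fin n → ℝ} {f : (Fin n → ℝ) → ℝ}
    {X : ℕ → Ω → (Fin n → ℝ)} {Y ν : ℕ → Ω → ℝ} (hXm : ∀ i, Measurable (X i))
    (hXB : ∀ i, ∀ᵐ ω ∂μ, X i ω ∈ Set.Icc l u)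
    (hXpos : ∀ S ⊆ Set.Icc l u, (interior S).Nonempty → 0 < μ (X 0 ⁻¹' S))
    (hY : ∀ i, ∀ᵐ ω ∂μ, Y i ω = f (X i ω) + ν i ω)
    (hind : Pairwise fun i j => IndepFun (fun ω => (X i ω, ν i ω)) (fun ω => (X j ω, ν j ω)) μ)
    (hident : ∀ i, IdentDistrib (fun ω => (X i ω, ν i ω)) (fun ω => (X 0 ω, ν 0 ω)) μ μ)
    (hνmean : μ[ν 0 | MeasurableSpace.comap (X 0) inferInstance] =ᵐ[μ] 0)
    (hνL2 : MemLp (ν 0) 2 μ) :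
    ∀ᵐ ω ∂μ, RegularSample l u f (fun i => X i ω) (fun i => Y i ω) (fun i => ν i ω) := by
  have hνint : Integrable (ν 0) μ := hνL2.integrable (by norm_num)
  have hνψ : ∀ ψ : (Fin n → ℝ) → ℝ, Measurable ψ → (∃ c, ∀ z ∈ Set.Icc l u, |ψ z| ≤ c) →
      ∀ᵐ ω ∂μ, Filter.Tendsto (fun m : ℕ => (∑ i ∈ Finset.range m, ν i ω * ψ (X i ω)) / m)
        Filter.atTop (nhds 0) := fun ψ hψ ⟨c, hc⟩ => by
    have hint : Integrable (fun ω => ν 0 ω * ψ (X 0 ω)) μ :=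
      hνint.mul_bdd (c := c) (hψ.comp (hXm 0)).aestronglyMeasurable
        ((hXB 0).mono fun ω hω => hc _ hω)
    have := ae_tendsto_average hind hident (Φ := fun p => p.2 * ψ p.1)
      (measurable_snd.mul (hψ.comp measurable_fst)) hint
    rwa [integral_mul_eq_zero_of_condExp_eq_zero (hXm 0) hνmean hνint hψ hint] at this
  have hfreq : ∀ᵐ ω ∂μ, ∀ U ∈ TopologicalSpace.countableBasis (Fin n → ℝ),
      Filter.Tendsto (fun m : ℕ => (∑ i ∈ Finset.range m,
        U.indicator (fun _ => (1 : ℝ)) (X i ω)) / m) Filter.atTop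
        (nhds (μ.real (X 0 ⁻¹' U))) := by
    refine (ae_ball_iff (TopologicalSpace.countable_countableBasis _)).2 fun U hU => ?_
    have hUm := (TopologicalSpace.isOpen_of_mem_countableBasis hU).measurableSet
    have hm : Measurable (U.indicator fun _ => (1 : ℝ)) := measurable_const.indicator hUm
    have heq : (fun ω => U.indicator (fun _ => (1 : ℝ)) (X 0 ω)) =
        (X 0 ⁻¹' U).indicator fun _ => (1 : ℝ) := rfl
    have := ae_tendsto_average hind hident (Φ := fun p => U.indicator (fun _ => (1 : ℝ)) p.1)
      (hm.comp measurable_fst)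
      (by rw [heq]; exact (integrable_const 1).indicator (hXm 0 hUm))
    simp only [heq] at this
    rwa [integral_indicator (hXm 0 hUm), setIntegral_const, smul_eq_mul, mul_one] at this
  have hsq := ae_tendsto_average hind hident (Φ := fun p => p.2 ^ 2)
    (measurable_snd.pow_const 2) hνL2.integrable_sq
  have hmono : ∀ᵐ ω ∂μ, ∀ s : Fin n →₀ ℕ, Filter.Tendsto (fun m : ℕ => (∑ i ∈ Finset.range m,
      ν i ω * MvPolynomial.eval (X i ω) (MvPolynomial.monomial s 1)) / m)
      Filter.atTop (nhds 0) := by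
    refine ae_all_iff.2 fun s => hνψ (fun w => MvPolynomial.eval w (MvPolynomial.monomial s 1))
      (MvPolynomial.continuous_eval _).measurable ?_
    exact isCompact_Icc.exists_bound_of_continuousOn (MvPolynomial.continuous_eval _).continuousOn
  have hcell : ∀ᵐ ω ∂μ, ∀ (N : ℕ) (z : Fin n → ℤ), Filter.Tendsto
      (fun m : ℕ => (∑ i ∈ Finset.range m, if (fun k => ⌊N * X i ω k⌋) = z then ν i ω else 0) / m)
        Filter.atTop (nhds 0) := by
    refine ae_all_iff.2 fun N => ae_all_iff.2 fun z => ?_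
    have hfl : Measurable fun (w : Fin n → ℝ) k => ⌊N * w k⌋ :=
      measurable_pi_iff.2 fun k => ((measurable_pi_apply k).const_mul _).floor
    have hm : MeasurableSet {w : Fin n → ℝ | (fun k => ⌊N * w k⌋) = z} :=
      hfl (measurableSet_singleton z)
    have := hνψ (fun w => if (fun k => ⌊N * w k⌋) = z then 1 else 0)
      (Measurable.ite hm measurable_const measurable_const)
      ⟨1, fun w _ => by split_ifs <;> simp⟩
    simpa only [mul_ite, mul_one, mul_zero] using this
  filter_upwards [ae_all_iff.2 hXB, ae_all_iff.2 hY, hfreq, hsq, hmono, hcell]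
    with ω h1 h2 h3 h4 h5 h6
  refine ⟨h1, h2, fun O hO ⟨w, hwO, hwB⟩ => ?_, ⟨_, h4⟩, fun p => ?_, h6⟩
  · obtain ⟨U, hU, hwU, hUO⟩ :=
      (TopologicalSpace.isBasis_countableBasis (Fin n → ℝ)).exists_subset_of_mem_open hwO hO
    have hUo := TopologicalSpace.isOpen_of_mem_countableBasis hU
    have hpos : 0 < μ.real (X 0 ⁻¹' U) := by
      have := hXpos (U ∩ Set.Icc l u) Set.inter_subset_right
        ⟨w, by rw [interior_inter, hUo.interior_eq]; exact ⟨hwU, hwB⟩⟩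
      exact ENNReal.toReal_pos (this.trans_le (measure_mono
        (Set.preimage_mono Set.inter_subset_left))).ne' (measure_ne_top _ _)
    refine ⟨_, half_pos hpos, ?_⟩
    filter_upwards [(h3 U hU).eventually (lt_mem_nhds (half_lt_self hpos)),
      Filter.eventually_gt_atTop 0] with m hm hm0
    have hm0 : (0 : ℝ) < m := by exact_mod_cast hm0
    refine ((lt_div_iff₀ hm0).1 hm).le.trans (Finset.sum_le_sum fun i _ => ?_)
    exact Set.indicator_le_indicator_of_subset hUO (fun _ => zero_le_one) _
  · have := tendsto_finsetSum p.support fun s (_ : s ∈ p.support) =>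
      (h5 s).const_mul (p.coeff s)
    simp only [mul_zero, Finset.sum_const_zero] at this
    refine this.congr fun m => ?_
    simp only [← mul_div_assoc]
    rw [← Finset.sum_div]
    congr 1
    simp only [Finset.mul_sum]
    rw [Finset.sum_comm]
    refine Finset.sum_congr rfl fun i _ => ?_
    conv_rhs => rw [p.as_sum, map_sum, Finset.mul_sum]
    refine Finset.sum_congr rfl fun s _ => ?_
    simp only [MvPolynomial.eval_monomial]
    ring

/-- The average noise energy in a layer tends to its expectation, which tends to 0 with the
thickness by dominated convergence, since `X 0` is almost surely interior. Thicknesses `1 / (j + 1)`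
keep the exceptional set null. -/
theorem ae_boundary_layer {n : ℕ} {Ω : Type*} [MeasurableSpace Ω] {μ : Measure Ω}
    [IsProbabilityMeasure μ] {l u : Fin n → ℝ} (hlu : ∀ k, l k < u k)
    {X : ℕ → Ω → (Fin n → ℝ)} {ν : ℕ → Ω → ℝ} (hXm : Measurable (X 0))
    (hXB : ∀ᵐ ω ∂μ, X 0 ω ∈ Set.Icc l u) (hbd : μ (X 0 ⁻¹' frontier (Set.Icc l u)) = 0)
    (hind : Pairwise fun i j => IndepFun (fun ω => (X i ω, ν i ω)) (fun ω => (X j ω, ν j ω)) μ)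
    (hident : ∀ i, IdentDistrib (fun ω => (X i ω, ν i ω)) (fun ω => (X 0 ω, ν 0 ω)) μ μ)
    (hνL2 : MemLp (ν 0) 2 μ) :
    ∀ᵐ ω ∂μ, ∀ η > 0, ∃ t > 0, ∀ᶠ m : ℕ in Filter.atTop, ∑ i ∈ Finset.range m,
      (innerBox l u t)ᶜ.indicator (fun _ => ν i ω ^ 2) (X i ω) ≤ η * m := by
  set t : ℕ → ℝ := fun j => 1 / ((j : ℝ) + 1) with ht
  have ht0 : ∀ j, 0 < t j := fun j => by positivity
  have hBm : ∀ s, MeasurableSet (innerBox l u s)ᶜ := fun s => measurableSet_Icc.compl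
  have hset : ∀ s, MeasurableSet (X 0 ⁻¹' (innerBox l u s)ᶜ) := fun s => hXm (hBm s)
  have heq : ∀ s, (fun ω => (innerBox l u s)ᶜ.indicator (fun _ => ν 0 ω ^ 2) (X 0 ω)) =
      (X 0 ⁻¹' (innerBox l u s)ᶜ).indicator fun ω => ν 0 ω ^ 2 := fun _ => rfl
  have havg : ∀ᵐ ω ∂μ, ∀ j, Filter.Tendsto (fun m : ℕ => (∑ i ∈ Finset.range m,
      (innerBox l u (t j))ᶜ.indicator (fun _ => ν i ω ^ 2) (X i ω)) / m) Filter.atTop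
      (nhds (∫ ω, (X 0 ⁻¹' (innerBox l u (t j))ᶜ).indicator (fun ω => ν 0 ω ^ 2) ω ∂μ)) := by
    refine ae_all_iff.2 fun j => ?_
    have hm : Measurable fun p : (Fin n → ℝ) × ℝ =>
        (innerBox l u (t j))ᶜ.indicator (fun _ => p.2 ^ 2) p.1 := by
      have : (fun p : (Fin n → ℝ) × ℝ => (innerBox l u (t j))ᶜ.indicator (fun _ => p.2 ^ 2) p.1) =
          (Prod.fst ⁻¹' (innerBox l u (t j))ᶜ).indicator fun p => p.2 ^ 2 := rfl
      rw [this]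
      exact (measurable_snd.pow_const 2).indicator (measurable_fst (hBm _))
    have := ae_tendsto_average hind hident hm
      (by simp only [heq]; exact hνL2.integrable_sq.indicator (hset _))
    simpa only [heq] using this
  have hlim : Filter.Tendsto
      (fun j => ∫ ω, (X 0 ⁻¹' (innerBox l u (t j))ᶜ).indicator (fun ω => ν 0 ω ^ 2) ω ∂μ)
      Filter.atTop (nhds 0) := by
    have hae : ∀ᵐ ω ∂μ, X 0 ω ∈ interior (Set.Icc l u) := by
      filter_upwards [hXB, measure_eq_zero_iff_ae_notMem.1 hbd] with ω h1 h2
      rw [Set.mem_preimage, isClosed_Icc.frontier_eq] at h2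
      by_contra h3
      exact h2 ⟨h1, h3⟩
    have := tendsto_integral_of_dominated_convergence (f := fun _ => (0 : ℝ)) (μ := μ)
      (F := fun j => (X 0 ⁻¹' (innerBox l u (t j))ᶜ).indicator fun ω => ν 0 ω ^ 2)
      (fun ω => ν 0 ω ^ 2)
      (fun j => (hνL2.integrable_sq.indicator (hset _)).aestronglyMeasurable) hνL2.integrable_sq
      (fun j => .of_forall fun ω => ?_) ?_
    · simpa using this
    · refine (norm_indicator_le_norm_self _ _).trans ?_
      rw [Real.norm_of_nonneg (sq_nonneg _)]
    · filter_upwards [hae] with ω hω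
      obtain ⟨s, hs0, hs⟩ := (isCompact_singleton (x := X 0 ω)).exists_subset_innerBox hlu
        (Set.singleton_subset_iff.2 hω)
      have hev : ∀ᶠ j in Filter.atTop, t j < s :=
        tendsto_one_div_add_atTop_nhds_zero_nat.eventually (gt_mem_nhds hs0)
      refine tendsto_const_nhds.congr' ?_
      filter_upwards [hev] with j hj
      exact (Set.indicator_of_notMem (fun h : ω ∈ X 0 ⁻¹' (innerBox l u (t j))ᶜ =>
        h (innerBox_subset hlu hj.le (hs rfl))) _).symm
  filter_upwards [havg] with ω hω η hη
  obtain ⟨j, hj⟩ := (hlim.eventually (gt_mem_nhds hη)).exists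
  exact ⟨t j, ht0 j, eventually_le_mul_of_tendsto_div (hω j) hj⟩

/-! ### The theorem -/

theorem lemma1 {n : ℕ} {Ω : Type*} [MeasurableSpace Ω] (μ : Measure Ω) [IsProbabilityMeasure μ]
    -- the full-dimensional box `B = Set.Icc l u`
    (l u : Fin n → ℝ) (hlu : ∀ k, l k < u k)
    -- the regression function, twice continuously differentiable and convex on `B`
    (f : (Fin n → ℝ) → ℝ) (hf : ContDiffOn ℝ 2 f (Set.Icc l u))
    (hfconv : ConvexOn ℝ (Set.Icc l u) f)
    (X : ℕ → Ω → (Fin n → ℝ)) (Y ν : ℕ → Ω → ℝ)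
    (hXm : ∀ i, Measurable (X i)) (hνm : ∀ i, Measurable (ν i))
    -- the features are iid with finite second moment
    (hXindep : iIndepFun X μ) (hXident : ∀ i, IdentDistrib (X i) (X 0) μ μ)
    (hXmom : Integrable (fun ω => ∑ k, (X 0 ω k) ^ 2) μ)
    -- they lie in `B` and charge every full-dimensional subset of `B`
    (hXB : ∀ i, ∀ᵐ ω ∂μ, X i ω ∈ Set.Icc l u)
    (hXpos : ∀ i, ∀ S ⊆ Set.Icc l u, (interior S).Nonempty → 0 < μ (X i ⁻¹' S))
    -- the responses, with noises that are conditionally independent given the features,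
    -- conditionally centred, square integrable, with a conditional law that is the same for all `i`
    (hY : ∀ i, ∀ᵐ ω ∂μ, Y i ω = f (X i ω) + ν i ω)
    (hνcond : ∀ (m : ℕ) (A : ℕ → Set ℝ), (∀ i, MeasurableSet (A i)) →
      μ⟦⋂ i ∈ Finset.range m, ν i ⁻¹' A i |
          ⨆ i ∈ Finset.range m, MeasurableSpace.comap (X i) inferInstance⟧
        =ᵐ[μ] fun ω => ∏ i ∈ Finset.range m,
          (μ⟦ν i ⁻¹' A i | MeasurableSpace.comap (X i) inferInstance⟧) ω)
    (hνident : ∀ i, IdentDistrib (fun ω => (X i ω, ν i ω)) (fun ω => (X 0 ω, ν 0 ω)) μ μ)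
    (hνmean : ∀ i, μ[ν i | MeasurableSpace.comap (X i) inferInstance] =ᵐ[μ] 0)
    (hνL2 : ∀ i, MemLp (ν i) 2 μ)
    -- a compact full-dimensional subset of `B` that contains no boundary point of `B`
    (C : Set (Fin n → ℝ)) (hC : IsCompact C) (hCint : (interior C).Nonempty)
    (hCB : C ⊆ Set.Icc l u) (hCbd : Disjoint C (frontier (Set.Icc l u))) :
    -- the regressors exist as soon as the sample is large enough
    (∀ᵐ ω ∂μ, ∃ m₀ : ℕ, ∀ m ≥ m₀, ∀ d : ℕ, ∃ g : MvPolynomial (Fin n) ℝ,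
      IsConvexRegressor l u (fun i => X i ω) (fun i => Y i ω) m d g) ∧
    -- iterated limit: `m → ∞`, then `d → ∞`
    (∀ᵐ ω ∂μ, ∀ ε > 0, ∃ d₀ : ℕ, ∀ d ≥ d₀, ∃ m₀ : ℕ, ∀ m ≥ m₀,
      ∀ g : MvPolynomial (Fin n) ℝ,
        IsConvexRegressor l u (fun i => X i ω) (fun i => Y i ω) m d g →
          ∀ x ∈ C, |MvPolynomial.eval x g - f x| ≤ ε) ∧
    -- joint limit, if the boundary of `B` is not charged
    (μ (X 0 ⁻¹' frontier (Set.Icc l u)) = 0 →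
      ∀ᵐ ω ∂μ, ∀ ε > 0, ∃ N : ℕ, ∀ m ≥ N, ∀ d ≥ N,
        ∀ g : MvPolynomial (Fin n) ℝ,
          IsConvexRegressor l u (fun i => X i ω) (fun i => Y i ω) m d g →
            ∀ x ∈ C, |MvPolynomial.eval x g - f x| ≤ ε) := by
  have hind : Pairwise fun i j =>
      IndepFun (fun ω => (X i ω, ν i ω)) (fun ω => (X j ω, ν j ω)) μ := fun i j hij =>
    pairwise_indepFun_of_conditional_indep hXm hνm hXindep hνcond hij
  have hreg := ae_regularSample hXm hXB (hXpos 0) hY hind hνident (hνmean 0) (hνL2 0)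
  -- Smoothness of `f` enters only through this Lipschitz bound on the closed box.
  obtain ⟨K, hK⟩ := hf.exists_lipschitzOnWith (by norm_num) (convex_Icc l u) isCompact_Icc
  have hCB' : C ⊆ interior (Set.Icc l u) := fun z hz => by
    by_contra h
    refine Set.disjoint_left.1 hCbd hz ?_
    rw [isClosed_Icc.frontier_eq]
    exact ⟨hCB hz, h⟩
  refine ⟨?_, ?_, fun hbd => ?_⟩
  · filter_upwards [hreg] with ω hs
    exact Filter.eventually_atTop.1 (hs.eventually_exists_regressor hlu)
  · filter_upwards [hreg] with ω hs ε hε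
    exact hs.iterated_limit hlu hK hfconv hC hCB' hε
  · filter_upwards [hreg, ae_boundary_layer hlu (hXm 0) (hXB 0) hbd hind hνident (hνL2 0)]
      with ω hs hlayer ε hε
    exact hs.joint_limit hlu hK hfconv hlayer hC hCB' hε
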